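/- Fix an integer $n\ge 1$ and rates $\lambda^n,\mu,\theta>0$. In the $M/M_{pc}/n+M_{pc}$ queue, customers arrive according to a Poisson process of rate $\lambda^n$ to a pool of $n$ identical agents and are served in order of arrival (FIFO). A customer enters service upon arrival if an agent is idle and otherwise waits in an infinite buffer; he abandons, without returning, if his patience runs out before his turn to enter service. The service requirements $S$ of arriving customers are i.i.d. exponential with mean $1/\mu$, independent of the arrival process, and the patience of a customer with service requirement $S$ is $T=\mu S/\theta$ (so that $T$ is exponential with mean $1/\theta$ and perfectly correlated with $S$). Let $X^n(t)$ be the number of customers in the system (in queue or in service) at time $t\ge 0$. The system may start from any, possibly random, initial condition that is independent of the arrivals after time $0$ and of their service requirements. An initial condition consists of a finite number $K$ of customers present, of whom $\min(K,n)$ are in service with given finite remaining service times, and the others wait in queue in order of arrival, with given elapsed waiting times and service requirements such that their patience has not yet run out. A probability distribution $\pi$ on $\{0,1,2,\dots\}$ is called a steady-state distribution of $X^n$ if for some such initial condition the process $X^n$ is strictly stationary and $X^n(t)$ has law $\pi$ for every $t\ge 0$. Theorem. $X^n$ has a unique steady-state distribution $\pi$, and for every initial condition as above $X^n(t)$ converges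 in distribution to $\pi$ as $t\to\infty$. -/

import Mathlib

open MeasureTheory ProbabilityTheory Filter

open scoped NNReal

namespace MpcQueue

/-- The offered wait of a customer arriving at time `a` at a FIFO system with `n` agents, when
`D j` are the epochs at which the earlier customers leave the system (after service or by
abandoning): the time until, for the first time, fewer than `n` of the earlier customers are still
in the system. Under FIFO this is when the turn of the customer to enter service comes, because
from then on all earlier customers still present are in service and an agent is free, and before
that every agent is busy or claimed by an earlier customer. -/
noncomputable def offeredWait (n : ℕ) (a : ℝ) {m : ℕ} (D : Fin m → ℝ) : ℝ :=
  sInf {v : ℝ | 0 ≤ v ∧ {j : Fin m | a + v < D j}.ncard < n}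

/-- Departure epoch of the `m`-th customer (in order of arrival) of the FIFO system with `n` agents,
where customer `j` arrives at `arr j` with service requirement `svc j` and patience
`μ * svc j / θ`. A customer whose offered wait does not exceed his patience enters service after the
offered wait and leaves when his service is completed; otherwise he abandons when his patience is
exhausted. -/
noncomputable def departure (n : ℕ) (μ θ : ℝ) (arr svc : ℕ → ℝ) (m : ℕ) : ℝ :=
  let v := offeredWait n (arr m) (fun j : Fin m => departure n μ θ arr svc j.1)
  if v ≤ μ * svc m / θ then arr m + v + svc m else arr m + μ * svc m / θ
termination_by m
decreasing_by exact j.2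

/-- The number of customers in the system (in queue or in service) at time `t`. -/
noncomputable def numberInSystem (n : ℕ) (μ θ : ℝ) (arr svc : ℕ → ℝ) (t : ℝ) : ℕ :=
  {m : ℕ | arr m ≤ t ∧ t < departure n μ θ arr svc m}.ncard

/-- The primitives of an `M/M_pc/n + M_pc` system with arrival rate `lam`, service rate `μ` and
patience rate `θ`, started at time `0` from an arbitrary, possibly random, initial condition.

The customers present at time `0` are numbered `0, …, K - 1` in the order of arrival. Those
with index `k < n` are in service, and `initSvc k` is the remaining service time. Those with index
`n ≤ k < K` are in queue: `initWait k` is the time already waited and `initSvc k` the service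
requirement; the patience of such a customer is `μ * initSvc k / θ`, and it has not run out yet. -/
structure System {Ω : Type*} [MeasurableSpace Ω] (P : Measure Ω) (n : ℕ) (lam μ θ : ℝ) where
  /-- the number of customers in the system at time `0` -/
  K : Ω → ℕ
  /-- the time already waited at time `0`, for the customers in queue -/
  initWait : ℕ → Ω → ℝ
  /-- remaining service time (in service) or service requirement (in queue) at time `0` -/
  initSvc : ℕ → Ω → ℝ
  /-- the interarrival times of the customers arriving after time `0` -/
  gap : ℕ → Ω → ℝ
  /-- the service requirements of the customers arriving after time `0` -/
  svc : ℕ → Ω → ℝ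
  measurable_K : Measurable K
  measurable_initWait : ∀ k, Measurable (initWait k)
  measurable_initSvc : ∀ k, Measurable (initSvc k)
  measurable_gap : ∀ i, Measurable (gap i)
  measurable_svc : ∀ i, Measurable (svc i)
  inService_pos : ∀ᵐ ω ∂P, ∀ k, k < n → k < K ω → 0 < initSvc k ω
  inQueue_wait_nonneg : ∀ᵐ ω ∂P, ∀ k, n ≤ k → k < K ω → 0 ≤ initWait k ω
  inQueue_patient : ∀ᵐ ω ∂P, ∀ k, n ≤ k → k < K ω → initWait k ω < μ * initSvc k ω / θ
  inQueue_ordered : ∀ᵐ ω ∂P, ∀ k, n ≤ k → k + 1 < K ω → initWait (k + 1) ω ≤ initWait k ω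
  /-- the interarrival times are exponential: arrivals form a Poisson process of rate `lam` -/
  gap_law : ∀ i, HasLaw (gap i) (expMeasure lam) P
  svc_law : ∀ i, HasLaw (svc i) (expMeasure μ) P
  /-- all interarrival times and service requirements are mutually independent -/
  indep : iIndepFun (fun i : ℕ ⊕ ℕ => Sum.elim gap svc i) P
  /-- the initial condition is independent of the arrivals after time `0` and their requirements -/
  indep_init : IndepFun
    (fun ω => (K ω, (fun k => initWait k ω), (fun k => initSvc k ω)))
    (fun ω => ((fun i => gap i ω), (fun i => svc i ω))) P

namespace System

variable {Ω : Type*} [MeasurableSpace Ω] {P : Measure Ω} {n : ℕ} {lam μ θ : ℝ}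

/-- Arrival epochs of all customers, the initial ones first. Initial customers in queue arrived
`initWait` time units before time `0`. For those in service only the remaining service time
matters, and they are treated as entering service at time `0` with that requirement. -/
noncomputable def arrivalEpoch (M : System P n lam μ θ) (ω : Ω) (m : ℕ) : ℝ :=
  if m < M.K ω then (if m < n then 0 else -M.initWait m ω)
  else ∑ i ∈ Finset.range (m - M.K ω + 1), M.gap i ω

/-- Service requirements of all customers, the initial ones first. -/
noncomputable def requirement (M : System P n lam μ θ) (ω : Ω) (m : ℕ) : ℝ :=
  if m < M.K ω then M.initSvc m ω else M.svc (m - M.K ω) ω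

/-- The number-in-system process. -/
noncomputable def X (M : System P n lam μ θ) (t : ℝ≥0) (ω : Ω) : ℕ :=
  numberInSystem n μ θ (M.arrivalEpoch ω) (M.requirement ω) t

end System

/-- `π` is a steady-state distribution of the number-in-system process: for a suitable initial
condition of the system, the process is strictly stationary, and its law at each time is `π`. -/
def IsSteadyState (n : ℕ) (lam μ θ : ℝ) (π : Measure ℕ) : Prop :=
  ∃ (Ω : Type) (_ : MeasurableSpace Ω) (P : Measure Ω) (_ : IsProbabilityMeasure P)
    (M : System P n lam μ θ),
    (∀ s : ℝ≥0, IdentDistrib (fun ω (t : ℝ≥0) => M.X (s + t) ω) (fun ω (t : ℝ≥0) => M.X t ω) P P) ∧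
    ∀ t : ℝ≥0, HasLaw (M.X t) π P

end MpcQueue

/-! A customer with requirement `S` stays at most `c * S` with `c = 1 + μ / θ`, whatever the
congestion: if he is served, he has waited at most his patience `μ * S / θ`, and otherwise he leaves
when it runs out (`departure_le`). So the system is dominated by an infinite-server queue in which
everyone stays `c * S`, and that queue is stable for every arrival rate. Call a customer a
regeneration if, even in the dominating queue, all earlier ones have left when he arrives
(`IsRegen`). From his arrival on, the system depends only on the arrivals and requirements from him
on, so two systems fed by the same noise then coincide (`departure_eq_of_tail`,
`numberInSystem_eq_of_tail`).

Regenerations recur. By a Chernoff bound (`noiseLaw_sum_lt_le`) each customer is one with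
probability at least a fixed `p > 0` (`exists_le_noiseLaw_isRegen`), so infinitely many occur with
probability at least `p`, hence almost surely by a zero-one law (`ae_mem_recurrentSet`). Every
initial condition is therefore forgotten: coupled with the initially empty system through the same
noise, it agrees with it from some random time on (`tendsto_integral_X_sub`). This gives uniqueness,
and also convergence once a steady state exists.

For existence, run the initially empty system. By memorylessness, the noise seen from time `s` on
has the original law and is independent of the state at `s` (`noiseLaw_restart`). Compare the state
at time `K + k` with that of a system started empty at time `K` and run for `k`. They can differ
only if no regeneration falls between these times, which has probability tending to `0` in `k`
uniformly in `K` (`tendsto_iSup_noiseLaw_noRegenSet`), because residual sojourns in the dominating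
queue are tight. Hence the laws of the pair (state, future noise) at integer times are Cauchy in
total variation and converge setwise to some `κ` (`exists_limit_restartPair`). Setwise limits keep
the law of the noise, its independence of the state, and the validity of the state, so `κ` is the
law of a genuine system; the same coupling shows that its path law is shift invariant
(`measureReal_pathFrom_shift`). -/

namespace MpcQueue

/-! ### Departure epochs -/

section Deterministic

open Classical in
theorem ncard_fin_eq_count {m : ℕ} (p : ℕ → Prop) :
    {j : Fin m | p j}.ncard = Nat.count p m := by
  rw [Nat.count_eq_card_filter_range]
  have h : ((fun j : Fin m => (j : ℕ)) '' {j : Fin m | p j}).ncard = {j : Fin m | p j}.ncard :=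
    Set.ncard_image_of_injective _ Fin.val_injective
  rw [← h, ← Set.ncard_coe_finset]
  congr 1
  ext x
  simp only [Set.mem_image, Set.mem_ofPred_eq, Finset.coe_filter, Finset.mem_range]
  constructor
  · rintro ⟨j, hj, rfl⟩
    exact ⟨j.2, hj⟩
  · rintro ⟨hx, hp⟩
    exact ⟨⟨x, hx⟩, hp, rfl⟩

theorem offeredWait_nonneg (n : ℕ) (a : ℝ) {m : ℕ} (D : Fin m → ℝ) : 0 ≤ offeredWait n a D :=
  Real.sInf_nonneg fun _ hv => hv.1

/-- The number of departures after `a + v` is nonincreasing and right-continuous in `v`, so the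
infimum is attained. This replaces the infimum by a count at a single epoch. -/
theorem offeredWait_le_iff {n : ℕ} (hn : 1 ≤ n) (a : ℝ) {m : ℕ} (D : Fin m → ℝ) {w : ℝ}
    (hw : 0 ≤ w) : offeredWait n a D ≤ w ↔ {j : Fin m | a + w < D j}.ncard < n := by
  set S := {v : ℝ | 0 ≤ v ∧ {j : Fin m | a + v < D j}.ncard < n} with hS
  have hbdd : BddBelow S := ⟨0, fun _ hv => hv.1⟩
  have hne : S.Nonempty := by
    obtain ⟨B, hB⟩ := (Set.finite_range D).bddAbove
    refine ⟨max 0 (B - a), le_max_left _ _, ?_⟩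
    have : {j : Fin m | a + max 0 (B - a) < D j} = ∅ := by
      ext j
      have h1 := hB ⟨j, rfl⟩
      have h2 := le_max_right 0 (B - a)
      simp only [Set.mem_ofPred_eq, Set.mem_empty_iff_false, iff_false, not_lt]
      linarith
    rw [this]
    simpa using Nat.lt_of_succ_le hn
  constructor
  · intro h
    set F := {j : Fin m | a + w < D j} with hF
    have hev : ∀ᶠ v in nhdsWithin w (Set.Ioi w), ∀ j ∈ F, a + v < D j := by
      rw [Filter.eventually_all_finite (Set.toFinite F)]
      intro j hj
      have : Set.Iio (D j - a) ∈ nhds w := Iio_mem_nhds (by have : a + w < D j := hj; linarith)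
      filter_upwards [mem_nhdsWithin_of_mem_nhds this] with v hv
      have : v < D j - a := hv
      linarith
    obtain ⟨v, hv, hwv⟩ := (hev.and self_mem_nhdsWithin).exists
    obtain ⟨u, hu, huv⟩ := exists_lt_of_csInf_lt hne (lt_of_le_of_lt h hwv)
    calc F.ncard ≤ {j : Fin m | a + u < D j}.ncard :=
          Set.ncard_le_ncard (fun j hj => by
            have h1 : a + v < D j := hv j hj
            have h2 : a + u < D j := by linarith
            exact h2) (Set.toFinite _)
      _ < n := hu.2
  · intro h
    exact csInf_le hbdd ⟨hw, h⟩

open Classical in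
theorem offeredWait_eq_sInf_count (n : ℕ) (a : ℝ) (m : ℕ) (D : ℕ → ℝ) :
    offeredWait n a (fun j : Fin m => D j) =
      sInf {v : ℝ | 0 ≤ v ∧ Nat.count (fun j => a + v < D j) m < n} := by
  rw [offeredWait]
  simp only [← ncard_fin_eq_count]

open Classical in
theorem offeredWait_le_iff_count {n : ℕ} (hn : 1 ≤ n) (a : ℝ) (m : ℕ) (D : ℕ → ℝ) {w : ℝ}
    (hw : 0 ≤ w) :
    offeredWait n a (fun j : Fin m => D j) ≤ w ↔ Nat.count (fun j => a + w < D j) m < n := by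
  rw [offeredWait_le_iff hn a _ hw, ncard_fin_eq_count (fun j => a + w < D j)]

/-- The offered wait of customer `m`. -/
noncomputable def wait (n : ℕ) (μ θ : ℝ) (arr svc : ℕ → ℝ) (m : ℕ) : ℝ :=
  offeredWait n (arr m) (fun j : Fin m => departure n μ θ arr svc j)

theorem departure_eq (n : ℕ) (μ θ : ℝ) (arr svc : ℕ → ℝ) (m : ℕ) :
    departure n μ θ arr svc m =
      if wait n μ θ arr svc m ≤ μ * svc m / θ then arr m + wait n μ θ arr svc m + svc m
      else arr m + μ * svc m / θ := by
  rw [departure]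
  rfl

variable {n : ℕ} {μ θ : ℝ}

theorem le_departure (hμ : 0 < μ) (hθ : 0 < θ) {arr svc : ℕ → ℝ} {m : ℕ} (h : 0 ≤ svc m) :
    arr m ≤ departure n μ θ arr svc m := by
  have h0 : 0 ≤ wait n μ θ arr svc m := offeredWait_nonneg _ _ _
  have h1 : 0 ≤ μ * svc m / θ := by positivity
  rw [departure_eq]
  split_ifs <;> linarith

/-- Whoever is served has waited no longer than his patience, so a sojourn never exceeds patience
plus requirement. This domination is why no stability condition is needed. -/
theorem departure_le {arr svc : ℕ → ℝ} {m : ℕ} (h : 0 ≤ svc m) :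
    departure n μ θ arr svc m ≤ arr m + (1 + μ / θ) * svc m := by
  have h1 : (1 + μ / θ) * svc m = svc m + μ * svc m / θ := by ring
  rw [departure_eq, h1]
  split_ifs <;> linarith

theorem departure_congr {arr svc arr' svc' : ℕ → ℝ} (m : ℕ)
    (h : ∀ j ≤ m, arr j = arr' j ∧ svc j = svc' j) :
    departure n μ θ arr svc m = departure n μ θ arr' svc' m := by
  induction m using Nat.strong_induction_on with
  | _ m ih =>
    have hw : wait n μ θ arr svc m = wait n μ θ arr' svc' m := by
      unfold wait
      rw [(h m le_rfl).1]
      congr 1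
      ext j
      exact ih j j.2 fun i hi => h i (hi.trans j.2.le)
    rw [departure_eq, departure_eq, hw, (h m le_rfl).1, (h m le_rfl).2]

/-- If two systems see the same customers from numbers `p` and `p'` on, and all the earlier
customers have left by then, then the common customers leave at the same epochs. -/
theorem departure_eq_of_tail {arr svc arr' svc' : ℕ → ℝ} {p p' : ℕ} {s : ℝ}
    (harr : ∀ j, arr (p + j) = arr' (p' + j) + s) (hsvc : ∀ j, svc (p + j) = svc' (p' + j))
    (h : ∀ i < p, ∀ j, departure n μ θ arr svc i ≤ arr (p + j))
    (h' : ∀ i < p', ∀ j, departure n μ θ arr' svc' i ≤ arr' (p' + j)) (j : ℕ) :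
    departure n μ θ arr svc (p + j) = departure n μ θ arr' svc' (p' + j) + s := by
  classical
  induction j using Nat.strong_induction_on with
  | _ j ih =>
    have hw : wait n μ θ arr svc (p + j) = wait n μ θ arr' svc' (p' + j) := by
      unfold wait
      rw [offeredWait_eq_sInf_count, offeredWait_eq_sInf_count]
      congr 1
      ext v
      simp only [Set.mem_ofPred_eq]
      refine and_congr_right fun hv => ?_
      have e : Nat.count (fun i => arr (p + j) + v < departure n μ θ arr svc i) (p + j) =
          Nat.count (fun i => arr' (p' + j) + v < departure n μ θ arr' svc' i) (p' + j) := by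
        rw [Nat.count_add, Nat.count_add]
        have z : Nat.count (fun i => arr (p + j) + v < departure n μ θ arr svc i) p = 0 := by
          rw [Nat.count_eq_card_filter_range, Finset.card_eq_zero, Finset.filter_eq_empty_iff]
          intro i hi
          have := h i (Finset.mem_range.1 hi) j
          rw [not_lt]; linarith
        have z' : Nat.count (fun i => arr' (p' + j) + v < departure n μ θ arr' svc' i) p' = 0 := by
          rw [Nat.count_eq_card_filter_range, Finset.card_eq_zero, Finset.filter_eq_empty_iff]
          intro i hi
          have := h' i (Finset.mem_range.1 hi) j
          rw [not_lt]; linarith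
        rw [z, z', zero_add, zero_add, Nat.count_eq_card_filter_range,
          Nat.count_eq_card_filter_range]
        congr 1
        refine Finset.filter_congr fun i hi => ?_
        rw [ih i (Finset.mem_range.1 hi), harr]
        constructor <;> intro _ <;> linarith
      rw [e]
    rw [departure_eq, departure_eq, hw, harr, hsvc]
    split_ifs <;> ring

/-- The coupling step: an arrival that finds both systems empty makes their futures coincide. The
shift `s` serves the comparison with a restarted system; `s = 0` with `p ≠ p'` serves the comparison
of different initial populations. -/
theorem numberInSystem_eq_of_tail {arr svc arr' svc' : ℕ → ℝ} {p p' : ℕ} {s : ℝ}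
    (harr : ∀ j, arr (p + j) = arr' (p' + j) + s) (hsvc : ∀ j, svc (p + j) = svc' (p' + j))
    (hmono : ∀ j, arr p ≤ arr (p + j))
    (h : ∀ i < p, departure n μ θ arr svc i ≤ arr p)
    (h' : ∀ i < p', departure n μ θ arr' svc' i ≤ arr' p') {t t' : ℝ} (ht : arr p ≤ t)
    (htt : t = t' + s) :
    numberInSystem n μ θ arr svc t = numberInSystem n μ θ arr' svc' t' := by
  have harr0 : arr p = arr' p' + s := harr 0
  have hD := departure_eq_of_tail (n := n) (μ := μ) (θ := θ) harr hsvc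
    (fun i hi j => (h i hi).trans (hmono j))
    (fun i hi j => (h' i hi).trans (by have := hmono j; rw [harr, harr0] at this; linarith))
  have key : ∀ (arr svc : ℕ → ℝ) (p : ℕ) (t : ℝ), (∀ i < p, departure n μ θ arr svc i ≤ t) →
      numberInSystem n μ θ arr svc t =
        {j | arr (p + j) ≤ t ∧ t < departure n μ θ arr svc (p + j)}.ncard := by
    intro arr svc p t hp
    rw [numberInSystem, ← Set.ncard_image_of_injective
      {j | arr (p + j) ≤ t ∧ t < departure n μ θ arr svc (p + j)} (add_right_injective p)]
    congr 1
    ext m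
    simp only [Set.mem_ofPred_eq, Set.mem_image]
    constructor
    · intro hm
      have hpm : p ≤ m := by
        by_contra hlt
        exact absurd (hp m (not_le.1 hlt)) (not_le.2 hm.2)
      exact ⟨m - p, by simpa [Nat.add_sub_cancel' hpm] using hm, Nat.add_sub_cancel' hpm⟩
    · rintro ⟨j, hj, rfl⟩
      exact hj
  rw [key arr svc p t fun i hi => (h i hi).trans ht,
    key arr' svc' p' t' fun i hi => (h' i hi).trans (by linarith)]
  congr 1
  ext j
  simp only [Set.mem_ofPred_eq]
  rw [hD, harr, htt]
  constructor <;> rintro ⟨_, _⟩ <;> constructor <;> linarith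

-- `Nat.count p` numbers the indices satisfying `p` consecutively, so counting among new numbers is
-- counting among old ones. In the restart argument `p` selects the customers who leave after `s`.
open Classical in
theorem count_comp_count {p q q' : ℕ → Prop} (m : ℕ) (hqp : ∀ j < m, q j → p j)
    (h : ∀ j < m, p j → (q' (Nat.count p j) ↔ q j)) :
    Nat.count q' (Nat.count p m) = Nat.count q m := by
  induction m with
  | zero => simp
  | succ m ih =>
    have ih' := ih (fun j hj => hqp j (hj.trans m.lt_succ_self))
      (fun j hj => h j (hj.trans m.lt_succ_self))
    by_cases hp : p m
    · have e : Nat.count p (m + 1) = Nat.count p m + 1 := by simp [Nat.count_succ, hp]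
      have e' := h m m.lt_succ_self hp
      rw [e, Nat.count_succ, ih', Nat.count_succ]
      simp [e']
    · have hq : ¬ q m := fun hq => hp (hqp m m.lt_succ_self hq)
      simp [Nat.count_succ, hp, hq, ih']

open Classical in
/-- The system restarted at time `s` from the customers still to leave (numbered consecutively):
these customers leave at the same epochs as in the original system. -/
theorem departure_restart (hn : 1 ≤ n) (hμ : 0 < μ) (hθ : 0 < θ) {arr svc arr' svc' : ℕ → ℝ}
    {s : ℝ}
    (hcases : ∀ m, s < departure n μ θ arr svc m →
      (Nat.count (fun j => s < departure n μ θ arr svc j) m < n ∧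
        arr' (Nat.count (fun j => s < departure n μ θ arr svc j) m) = 0 ∧
        svc' (Nat.count (fun j => s < departure n μ θ arr svc j) m) =
          departure n μ θ arr svc m - s) ∨
      ((arr m ≤ s → n ≤ Nat.count (fun j => s < departure n μ θ arr svc j) m) ∧
        arr' (Nat.count (fun j => s < departure n μ θ arr svc j) m) = arr m - s ∧
        svc' (Nat.count (fun j => s < departure n μ θ arr svc j) m) = svc m))
    (m : ℕ) (hm : s < departure n μ θ arr svc m) :
    departure n μ θ arr' svc' (Nat.count (fun j => s < departure n μ θ arr svc j) m) =
      departure n μ θ arr svc m - s := by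
  induction m using Nat.strong_induction_on with
  | _ m ih =>
    set D := departure n μ θ arr svc with hD
    set D' := departure n μ θ arr' svc' with hD'
    set pos := Nat.count (fun j => s < D j) with hpos
    rcases hcases m hm with ⟨h1, h2, h3⟩ | ⟨h1, h2, h3⟩
    -- A customer with fewer than `n` remaining predecessors is in service at once, with his
    -- remaining sojourn as requirement.
    · have hw : wait n μ θ arr' svc' (pos m) = 0 := by
        refine le_antisymm ?_ (offeredWait_nonneg _ _ _)
        unfold wait
        rw [offeredWait_le_iff_count hn _ _ _ le_rfl]
        exact lt_of_le_of_lt (Nat.count_le _) h1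
      have hp : 0 ≤ μ * svc' (pos m) / θ := by
        rw [h3]
        have : 0 < D m - s := by linarith
        positivity
      rw [hD', departure_eq, hw, if_pos hp, h2, h3]
      ring
    · have hw : wait n μ θ arr' svc' (pos m) = wait n μ θ arr svc m := by
        unfold wait
        rw [offeredWait_eq_sInf_count, offeredWait_eq_sInf_count]
        congr 1
        ext v
        simp only [Set.mem_ofPred_eq]
        refine and_congr_right fun hv => ?_
        rw [h2]
        rcases le_or_gt s (arr m + v) with hs | hs
        · have := count_comp_count (p := fun j => s < D j)
            (q := fun j => arr m + v < D j) (q' := fun j => arr m - s + v < D' j) m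
            (fun j _ hj => lt_of_le_of_lt hs hj) (fun j hj hpj => by
              show arr m - s + v < D' (pos j) ↔ _
              rw [ih j hj hpj]
              constructor <;> intro _ <;> linarith)
          rw [← this]
        -- At epochs before `s` the two counts may differ, since the restarted system has lost the
        -- customers who left before `s`. Both are at least `n`, however, so neither system admits
        -- the customer there.
        · have hnpos := h1 (by linarith)
          have e1 : Nat.count (fun j => arr m - s + v < D' j) (pos m) = pos m := by
            have := count_comp_count (p := fun j => s < D j)
              (q := fun j => s < D j) (q' := fun j => arr m - s + v < D' j) m
              (fun j _ hj => hj) (fun j hj hpj => by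
                show arr m - s + v < D' (pos j) ↔ _
                rw [ih j hj hpj]
                constructor
                · intro _; exact hpj
                · intro h; linarith)
            rw [← hpos] at this
            exact this
          have e2 : pos m ≤ Nat.count (fun j => arr m + v < D j) m :=
            Nat.count_mono_left fun j _ hj => hs.trans hj
          change Nat.count (fun j => arr m - s + v < D' j) (pos m) < n ↔
            Nat.count (fun j => arr m + v < D j) m < n
          omega
      rw [hD', departure_eq, hw, h2, h3, hD, departure_eq]
      split_ifs <;> ring

-- The renumbering is a bijection between the customers counted in the two systems, with inverse
-- `Nat.nth`; this is where infinitely many remaining customers are needed. The condition `arr m ≤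
-- s` in the first case ensures that the artificial arrival epoch `0` does not change who has
-- arrived.
open Classical in
theorem numberInSystem_restart (hn : 1 ≤ n) (hμ : 0 < μ) (hθ : 0 < θ)
    {arr svc arr' svc' : ℕ → ℝ} {s : ℝ}
    (hcases : ∀ m, s < departure n μ θ arr svc m →
      (Nat.count (fun j => s < departure n μ θ arr svc j) m < n ∧ arr m ≤ s ∧
        arr' (Nat.count (fun j => s < departure n μ θ arr svc j) m) = 0 ∧
        svc' (Nat.count (fun j => s < departure n μ θ arr svc j) m) =
          departure n μ θ arr svc m - s) ∨
      ((arr m ≤ s → n ≤ Nat.count (fun j => s < departure n μ θ arr svc j) m) ∧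
        arr' (Nat.count (fun j => s < departure n μ θ arr svc j) m) = arr m - s ∧
        svc' (Nat.count (fun j => s < departure n μ θ arr svc j) m) = svc m))
    (hinf : {m | s < departure n μ θ arr svc m}.Infinite) {t : ℝ} (ht : 0 ≤ t) :
    numberInSystem n μ θ arr' svc' t = numberInSystem n μ θ arr svc (s + t) := by
  have hD := departure_restart hn hμ hθ (arr := arr) (svc := svc) (arr' := arr') (svc' := svc')
    (s := s) (fun m hm => (hcases m hm).imp (fun h => ⟨h.1, h.2.2⟩) id)
  set D := departure n μ θ arr svc with hDdef
  have harr : ∀ m, s < D m → (arr' (Nat.count (fun j => s < D j) m) ≤ t ↔ arr m ≤ s + t) := by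
    intro m hm
    rcases hcases m hm with ⟨_, h2, h3, _⟩ | ⟨_, h3, _⟩
    · rw [h3]; constructor <;> intro _ <;> linarith
    · rw [h3]; constructor <;> intro _ <;> linarith
  rw [numberInSystem, numberInSystem]
  have himg : {k | arr' k ≤ t ∧ t < departure n μ θ arr' svc' k} =
      Nat.count (fun j => s < D j) '' {m | arr m ≤ s + t ∧ s + t < D m} := by
    ext k
    simp only [Set.mem_ofPred_eq, Set.mem_image]
    constructor
    · intro hk
      have hmem : s < D (Nat.nth (fun j => s < D j) k) := Nat.nth_mem_of_infinite hinf k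
      have hcount : Nat.count (fun j => s < D j) (Nat.nth (fun j => s < D j) k) = k :=
        Nat.count_nth_of_infinite hinf k
      refine ⟨Nat.nth (fun j => s < D j) k, ⟨?_, ?_⟩, hcount⟩
      · rw [← harr _ hmem, hcount]; exact hk.1
      · have := hD _ hmem
        rw [hcount] at this
        linarith [hk.2]
    · rintro ⟨m, ⟨h1, h2⟩, rfl⟩
      have hm : s < D m := by linarith
      refine ⟨(harr m hm).2 h1, ?_⟩
      rw [hD m hm]; linarith
  rw [himg, Set.InjOn.ncard_image]
  intro a ha b hb hab
  have ha' : s < D a := by have := ha.2; linarith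
  have hb' : s < D b := by have := hb.2; linarith
  exact Nat.count_injective ha' hb' hab

end Deterministic

/-! ### The system as a function of its driving noise -/

/-- Interarrival times (left) and service requirements (right). -/
abbrev Noise : Type := ℕ ⊕ ℕ → ℝ

/-- Number in system, elapsed waiting times and (remaining) service requirements. -/
abbrev InitState : Type := ℕ × (ℕ → ℝ) × (ℕ → ℝ)

/-- Arrival epochs of the customers arriving after time `0`. -/
noncomputable def arrivals (d : Noise) (m : ℕ) : ℝ := ∑ i ∈ Finset.range (m + 1), d (Sum.inl i)

/-- Service requirements of the customers arriving after time `0`. -/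
def reqs (d : Noise) (m : ℕ) : ℝ := d (Sum.inr m)

/-- Departure epochs in the system that starts empty. -/
noncomputable def dep (n : ℕ) (μ θ : ℝ) (d : Noise) (m : ℕ) : ℝ :=
  departure n μ θ (arrivals d) (reqs d) m

/-- The number in system when the system starts empty. -/
noncomputable def emptyPath (n : ℕ) (μ θ : ℝ) (d : Noise) (t : ℝ≥0) : ℕ :=
  numberInSystem n μ θ (arrivals d) (reqs d) t

/-- Arrival epochs for a given initial state and noise. -/
noncomputable def arrivalsFrom (n : ℕ) (x : InitState × Noise) (m : ℕ) : ℝ :=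
  if m < x.1.1 then (if m < n then 0 else -x.1.2.1 m)
  else ∑ i ∈ Finset.range (m - x.1.1 + 1), x.2 (Sum.inl i)

/-- Service requirements for a given initial state and noise. -/
noncomputable def reqsFrom (x : InitState × Noise) (m : ℕ) : ℝ :=
  if m < x.1.1 then x.1.2.2 m else x.2 (Sum.inr (m - x.1.1))

/-- The number in system for a given initial state and noise. -/
noncomputable def pathFrom (n : ℕ) (μ θ : ℝ) (x : InitState × Noise) (t : ℝ≥0) : ℕ :=
  numberInSystem n μ θ (arrivalsFrom n x) (reqsFrom x) t

/-- Positive interarrival times and requirements, and finitely many arrivals in finite time. -/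
def Good (d : Noise) : Prop := (∀ i, 0 < d i) ∧ Tendsto (arrivals d) atTop atTop

/-- The number of arrivals up to time `s`. -/
noncomputable def countBefore (s : ℝ) (d : Noise) : ℕ := sInf {i | s < arrivals d i}

/-- Drop the first `k` customers and shorten the next interarrival time by `u`. -/
noncomputable def shiftNoise (k : ℕ) (u : ℝ) (d : Noise) : Noise :=
  Sum.elim (fun i => d (Sum.inl (k + i)) - if i = 0 then u else 0) (fun i => d (Sum.inr (k + i)))

/-- The noise seen from time `s` on. -/
noncomputable def restartNoise (s : ℝ) (d : Noise) : Noise :=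
  shiftNoise (countBefore s d) (s - ∑ i ∈ Finset.range (countBefore s d), d (Sum.inl i)) d

open Classical in
/-- The state at time `s` of the initially empty system, if `k` customers have arrived by then. -/
noncomputable def stateAt (n : ℕ) (μ θ s : ℝ) (k : ℕ) (d : Noise) : InitState :=
  (Nat.count (fun j => s < dep n μ θ d j) k,
    fun i => ∑ m ∈ Finset.range k,
      if s < dep n μ θ d m ∧ Nat.count (fun j => s < dep n μ θ d j) m = i
      then s - arrivals d m else 0,
    fun i => ∑ m ∈ Finset.range k,
      if s < dep n μ θ d m ∧ Nat.count (fun j => s < dep n μ θ d j) m = i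
      then (if i < n then dep n μ θ d m - s else reqs d m) else 0)

/-- The state at time `s` of the initially empty system. -/
noncomputable def state (n : ℕ) (μ θ s : ℝ) (d : Noise) : InitState :=
  stateAt n μ θ s (countBefore s d) d

/-- Customer `i` finds all the earlier customers gone, even if each of them stays `c` times his
service requirement. -/
def IsRegen (c : ℝ) (d : Noise) (i : ℕ) : Prop :=
  ∀ j < i, arrivals d j + c * reqs d j ≤ arrivals d i

/-! ### Pathwise restart of the initially empty system at time `s`. -/

section Noise

variable {n : ℕ} {μ θ : ℝ} {d : Noise} {s t : ℝ}

theorem arrivals_succ (d : Noise) (m : ℕ) :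
    arrivals d (m + 1) = arrivals d m + d (Sum.inl (m + 1)) :=
  Finset.sum_range_succ _ _

theorem Good.strictMono (hd : Good d) : StrictMono (arrivals d) :=
  strictMono_nat_of_lt_succ fun m => by
    rw [arrivals_succ]
    linarith [hd.1 (Sum.inl (m + 1))]

/-- Divergence of the arrival epochs rules out the infimum of the empty set, which would be the
default value `0`. -/
theorem Good.lt_countBefore_iff (hd : Good d) (s : ℝ) (i : ℕ) :
    i < countBefore s d ↔ arrivals d i ≤ s := by
  have hne : {i | s < arrivals d i}.Nonempty := (hd.2.eventually_gt_atTop s).exists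
  constructor
  · intro h
    by_contra hlt
    exact absurd (Nat.sInf_le (show i ∈ {i | s < arrivals d i} from not_le.1 hlt)) (not_le.2 h)
  · intro h
    by_contra hle
    have h1 : s < arrivals d (countBefore s d) := Nat.sInf_mem hne
    exact absurd (hd.strictMono.monotone (not_lt.1 hle)) (by rw [not_le]; linarith)

theorem arrivals_shiftNoise (k : ℕ) (u : ℝ) (d : Noise) (i : ℕ) :
    arrivals (shiftNoise k u d) i =
      arrivals d (k + i) - (u + ∑ i ∈ Finset.range k, d (Sum.inl i)) := by
  have : ∑ j ∈ Finset.range (i + 1), (if j = 0 then u else 0) = u := by simp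
  simp only [arrivals, shiftNoise, Sum.elim_inl, Finset.sum_sub_distrib, this]
  rw [add_assoc k i 1, Finset.sum_range_add _ k (i + 1)]
  ring

theorem arrivals_restartNoise (s : ℝ) (d : Noise) (i : ℕ) :
    arrivals (restartNoise s d) i = arrivals d (countBefore s d + i) - s := by
  rw [restartNoise, arrivals_shiftNoise]
  ring

theorem reqs_restartNoise (s : ℝ) (d : Noise) (i : ℕ) :
    reqs (restartNoise s d) i = reqs d (countBefore s d + i) := rfl

theorem Good.restart (hd : Good d) (s : ℝ) : Good (restartNoise s d) := by
  refine ⟨?_, ?_⟩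
  · rintro (i | i)
    · have hs : s < arrivals d (countBefore s d) :=
        not_le.1 fun h => lt_irrefl _ ((hd.lt_countBefore_iff s _).2 h)
      rcases i with _ | i
      · rw [arrivals, Finset.sum_range_succ] at hs
        simp only [restartNoise, shiftNoise, Sum.elim_inl, if_true, add_zero]
        linarith
      · simpa [restartNoise, shiftNoise] using hd.1 _
    · exact hd.1 _
  · have : arrivals (restartNoise s d) = fun i => arrivals d (countBefore s d + i) - s :=
      funext fun i => arrivals_restartNoise s d i
    rw [this]
    refine tendsto_atTop_add_const_right _ (-s) (hd.2.comp ?_)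
    exact tendsto_atTop_mono (fun a => Nat.le_add_left a _) tendsto_id

theorem Good.countBefore_add (hd : Good d) (ht : 0 ≤ t) :
    countBefore (t + s) d = countBefore s d + countBefore t (restartNoise s d) := by
  have h : ∀ i, i < countBefore (t + s) d ↔
      i < countBefore s d + countBefore t (restartNoise s d) := by
    intro i
    rw [hd.lt_countBefore_iff]
    rcases lt_or_ge i (countBefore s d) with hi | hi
    · have := (hd.lt_countBefore_iff s i).1 hi
      exact ⟨fun _ => by omega, fun _ => by linarith⟩
    · obtain ⟨j, rfl⟩ := Nat.exists_eq_add_of_le hi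
      rw [add_lt_add_iff_left, (hd.restart s).lt_countBefore_iff, arrivals_restartNoise]
      constructor <;> intro _ <;> linarith
  have h1 := h (countBefore (t + s) d)
  have h2 := h (countBefore s d + countBefore t (restartNoise s d))
  omega

/-- Interarrival times are the increments of the arrival epochs, so it suffices to compare the
epochs, and the arrival counts add up. -/
theorem Good.restart_add (hd : Good d) (ht : 0 ≤ t) :
    restartNoise (t + s) d =
      restartNoise t (restartNoise s d) := by
  have hA : arrivals (restartNoise (t + s) d) =
      arrivals (restartNoise t (restartNoise s d)) := by
    ext i
    rw [arrivals_restartNoise, arrivals_restartNoise, arrivals_restartNoise, hd.countBefore_add ht,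
      add_assoc (countBefore s d)]
    ring
  funext i
  rcases i with i | i
  · rcases i with _ | i
    · simpa [arrivals] using congrFun hA 0
    · have h1 := congrFun hA (i + 1)
      have h0 := congrFun hA i
      rw [arrivals_succ, arrivals_succ, h0] at h1
      exact add_left_cancel h1
  · change reqs (restartNoise (t + s) d) i = reqs (restartNoise t _) i
    rw [reqs_restartNoise, reqs_restartNoise, reqs_restartNoise, hd.countBefore_add ht, add_assoc]

theorem Good.le_dep (hd : Good d) (hμ : 0 < μ) (hθ : 0 < θ) (m : ℕ) :
    arrivals d m ≤ dep n μ θ d m :=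
  le_departure hμ hθ (hd.1 _).le

theorem Good.dep_le (hd : Good d) (m : ℕ) :
    dep n μ θ d m ≤ arrivals d m + (1 + μ / θ) * reqs d m :=
  departure_le (hd.1 _).le

/-- The sum in `stateAt` has only one nonzero term, because `Nat.count` is injective on the
customers still present. -/
theorem stateAt_wait {k m : ℕ} (hm : m < k) (hs : s < dep n μ θ d m) :
    (stateAt n μ θ s k d).2.1 (Nat.count (fun j => s < dep n μ θ d j) m) = s - arrivals d m := by
  classical
  simp only [stateAt]
  rw [Finset.sum_eq_single m]
  · rw [if_pos ⟨hs, by congr⟩]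
  · intro b _ hbm
    rw [if_neg]
    rintro ⟨h1, h2⟩
    exact hbm (Nat.count_injective h1 hs (by convert h2))
  · intro h
    exact absurd (Finset.mem_range.2 hm) h

theorem stateAt_svc {k m : ℕ} (hm : m < k) (hs : s < dep n μ θ d m) :
    (stateAt n μ θ s k d).2.2 (Nat.count (fun j => s < dep n μ θ d j) m) =
      if Nat.count (fun j => s < dep n μ θ d j) m < n then dep n μ θ d m - s else reqs d m := by
  classical
  simp only [stateAt]
  rw [Finset.sum_eq_single m]
  · rw [if_pos ⟨hs, by congr⟩]
  · intro b _ hbm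
    rw [if_neg]
    rintro ⟨h1, h2⟩
    exact hbm (Nat.count_injective h1 hs (by convert h2))
  · intro h
    exact absurd (Finset.mem_range.2 hm) h

/-- The pathwise Markov property: customers in service, in queue, and still to arrive at time `s`
fit the cases of `numberInSystem_restart`. -/
theorem Good.emptyPath_add (hd : Good d) (hn : 1 ≤ n) (hμ : 0 < μ) (hθ : 0 < θ) (s t : ℝ≥0) :
    emptyPath n μ θ d (s + t) = pathFrom n μ θ (state n μ θ s d, restartNoise s d) t := by
  classical
  have hbig : ∀ m, countBefore s d ≤ m → (s : ℝ) < dep n μ θ d m := fun m hm =>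
    lt_of_lt_of_le (not_le.1 fun h => absurd ((hd.lt_countBefore_iff s m).2 h) (not_lt.2 hm))
      (hd.le_dep hμ hθ m)
  rw [emptyPath, pathFrom, NNReal.coe_add]
  symm
  refine numberInSystem_restart hn hμ hθ ?_ ?_ t.2
  · intro m hm
    change (s : ℝ) < dep n μ θ d m at hm
    set pos := Nat.count (fun j => (s : ℝ) < departure n μ θ (arrivals d) (reqs d) j) with hpos
    have hK : (state n μ θ s d).1 = pos (countBefore s d) := by
      simp only [state, stateAt, hpos]; rfl
    rcases lt_or_ge m (countBefore s d) with hlt | hge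
    · have hposlt : pos m < (state n μ θ s d).1 := by
        rw [hK]
        exact Nat.count_strict_mono hm hlt
      have hA := (hd.lt_countBefore_iff s m).1 hlt
      have hw : (state n μ θ s d).2.1 (pos m) = s - arrivals d m := stateAt_wait hlt hm
      have hv : (state n μ θ s d).2.2 (pos m) =
        if pos m < n then dep n μ θ d m - s else reqs d m := stateAt_svc hlt hm
      rcases lt_or_ge (pos m) n with hpn | hpn
      · left
        refine ⟨hpn, hA, ?_, ?_⟩
        · simp only [arrivalsFrom]
          rw [if_pos hposlt, if_pos hpn]
        · simp only [reqsFrom]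
          rw [if_pos hposlt, hv, if_pos hpn]
          rfl
      · right
        refine ⟨fun _ => hpn, ?_, ?_⟩
        · simp only [arrivalsFrom]
          rw [if_pos hposlt, if_neg (not_lt.2 hpn), hw]
          ring
        · simp only [reqsFrom]
          rw [if_pos hposlt, hv, if_neg (not_lt.2 hpn)]
    · right
      obtain ⟨i, rfl⟩ := Nat.exists_eq_add_of_le hge
      have hposeq : pos (countBefore s d + i) = (state n μ θ s d).1 + i := by
        rw [hK, hpos, Nat.count_add]
        congr 1
        rw [Nat.count_iff_forall]
        intro j _
        exact hbig _ (Nat.le_add_right _ _)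
      refine ⟨fun h => absurd ((hd.lt_countBefore_iff s _).2 h) (by omega), ?_, ?_⟩
      · simp only [arrivalsFrom]
        rw [hposeq, if_neg (by omega), Nat.add_sub_cancel_left]
        exact arrivals_restartNoise s d i
      · simp only [reqsFrom]
        rw [hposeq, if_neg (by omega), Nat.add_sub_cancel_left]
        exact reqs_restartNoise s d i
  · exact (Set.infinite_of_injective_forall_mem (add_right_injective (countBefore s d))
      fun i => hbig _ (Nat.le_add_right _ _))

/-! ### Coupling of the original and the restarted system at a regeneration. -/

section Regeneration

variable {p : ℕ}

/-- The restarted noise drives the system emptied at time `s`. A regeneration clears both systems,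
since the bound `c * S` on sojourns holds in each of them. -/
theorem Good.dep_restartNoise (hd : Good d) (s : ℝ)
    (hp : IsRegen (1 + μ / θ) d (countBefore s d + p)) (j : ℕ) :
    dep n μ θ d (countBefore s d + p + j) = dep n μ θ (restartNoise s d) (p + j) + s := by
  refine departure_eq_of_tail ?_ ?_ ?_ ?_ j
  · intro j
    rw [arrivals_restartNoise, add_assoc]
    ring
  · intro j
    rw [reqs_restartNoise, add_assoc]
  · intro i hi j
    exact (hd.dep_le i).trans ((hp i hi).trans (hd.strictMono.monotone (Nat.le_add_right _ _)))
  · intro i hi j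
    refine ((hd.restart s).dep_le i).trans ?_
    refine le_trans ?_ ((hd.restart s).strictMono.monotone (Nat.le_add_right p j))
    rw [arrivals_restartNoise, arrivals_restartNoise, reqs_restartNoise]
    linarith [hp (countBefore s d + i) (by omega)]

theorem Good.emptyPath_restartNoise (hd : Good d) (s : ℝ≥0)
    (hp : IsRegen (1 + μ / θ) d (countBefore s d + p)) {t : ℝ≥0}
    (ht : arrivals (restartNoise s d) p ≤ t) :
    emptyPath n μ θ d (s + t) = emptyPath n μ θ (restartNoise s d) t := by
  have hA := arrivals_restartNoise s d p
  refine numberInSystem_eq_of_tail (p := countBefore s d + p) (p' := p) (s := s) ?_ ?_ ?_ ?_ ?_ ?_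
    (by rw [NNReal.coe_add]; ring)
  · intro j
    rw [arrivals_restartNoise, add_assoc]
    ring
  · intro j
    rw [reqs_restartNoise, add_assoc]
  · intro j
    exact hd.strictMono.monotone (Nat.le_add_right _ _)
  · intro i hi
    exact (hd.dep_le i).trans (hp i hi)
  · intro i hi
    refine ((hd.restart s).dep_le i).trans ?_
    rw [arrivals_restartNoise, arrivals_restartNoise, reqs_restartNoise]
    linarith [hp (countBefore s d + i) (by omega)]
  · rw [NNReal.coe_add]
    linarith

/-- Existence needs the whole state to couple, since the limit must be the law of an initial
condition. Customers before the regeneration drop out of every count and sum, and the later ones are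
matched one by one. -/
theorem Good.state_add (hd : Good d) (ht : 0 ≤ t)
    (hp : IsRegen (1 + μ / θ) d (countBefore s d + p))
    (htp : arrivals (restartNoise s d) p ≤ t) :
    state n μ θ (t + s) d = state n μ θ t (restartNoise s d) := by
  classical
  set d' := restartNoise s d with hd'
  have hgd' : Good d' := hd.restart s
  have hAp : arrivals d' p = arrivals d (countBefore s d + p) - s := arrivals_restartNoise s d p
  have hdep := hd.dep_restartNoise (n := n) s hp
  have hlt : p < countBefore t d' := (hgd'.lt_countBefore_iff t p).2 htp
  obtain ⟨q, hq⟩ := Nat.exists_eq_add_of_le hlt.le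
  have hN : countBefore (t + s) d = countBefore s d + p + q := by
    rw [hd.countBefore_add ht, hq, add_assoc]
  have h1 : ∀ i < countBefore s d + p, ¬ (t + s < dep n μ θ d i) := by
    intro i hi
    have := (hd.dep_le (n := n) (μ := μ) (θ := θ) i).trans (hp i hi)
    rw [not_lt]
    linarith
  have h2 : ∀ i < p, ¬ (t < dep n μ θ d' i) := by
    intro i hi
    have h3 := hgd'.dep_le (n := n) (μ := μ) (θ := θ) i
    have h4 := hp (countBefore s d + i) (by omega)
    rw [arrivals_restartNoise, reqs_restartNoise] at h3
    rw [not_lt]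
    linarith
  have h3 : ∀ j, t + s < dep n μ θ d (countBefore s d + p + j) ↔ t < dep n μ θ d' (p + j) := by
    intro j
    rw [hdep, add_lt_add_iff_right]
  have hcount : ∀ j, Nat.count (fun j => t + s < dep n μ θ d j) (countBefore s d + p + j) =
      Nat.count (fun j => t < dep n μ θ d' j) (p + j) := by
    intro j
    rw [Nat.count_add _ (countBefore s d + p) j, Nat.count_add _ p j]
    have z1 : Nat.count (fun j => t + s < dep n μ θ d j) (countBefore s d + p) = 0 := by
      rw [Nat.count_eq_card_filter_range, Finset.card_eq_zero, Finset.filter_eq_empty_iff]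
      exact fun i hi => h1 i (Finset.mem_range.1 hi)
    have z2 : Nat.count (fun j => t < dep n μ θ d' j) p = 0 := by
      rw [Nat.count_eq_card_filter_range, Finset.card_eq_zero, Finset.filter_eq_empty_iff]
      exact fun i hi => h2 i (Finset.mem_range.1 hi)
    rw [z1, z2]
    simp only [h3]
  have hA : ∀ j, arrivals d (countBefore s d + p + j) = arrivals d' (p + j) + s := by
    intro j
    rw [hd', arrivals_restartNoise, add_assoc]
    ring
  have hS : ∀ j, reqs d (countBefore s d + p + j) = reqs d' (p + j) := by
    intro j
    rw [hd', reqs_restartNoise, add_assoc]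
  unfold state stateAt
  rw [hN, hq]
  refine Prod.ext ?_ (Prod.ext ?_ ?_)
  · convert hcount q
  · funext i
    simp only
    rw [Finset.sum_range_add _ (countBefore s d + p) q, Finset.sum_range_add _ p q]
    refine congrArg₂ (· + ·) (Eq.trans (Finset.sum_eq_zero fun j hj => ?_)
      (Finset.sum_eq_zero fun j hj => ?_).symm) ?_
    · exact if_neg fun h => h1 j (Finset.mem_range.1 hj) h.1
    · exact if_neg fun h => h2 j (Finset.mem_range.1 hj) h.1
    · refine Finset.sum_congr rfl fun j _ => ?_
      have e : (t + s < dep n μ θ d (countBefore s d + p + j) ∧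
          Nat.count (fun j => t + s < dep n μ θ d j) (countBefore s d + p + j) = i) ↔
          (t < dep n μ θ d' (p + j) ∧ Nat.count (fun j => t < dep n μ θ d' j) (p + j) = i) := by
        rw [h3, hcount]
      refine if_congr (by convert e) ?_ rfl
      rw [hA]
      ring
  · funext i
    simp only
    rw [Finset.sum_range_add _ (countBefore s d + p) q, Finset.sum_range_add _ p q]
    refine congrArg₂ (· + ·) (Eq.trans (Finset.sum_eq_zero fun j hj => ?_)
      (Finset.sum_eq_zero fun j hj => ?_).symm) ?_
    · exact if_neg fun h => h1 j (Finset.mem_range.1 hj) h.1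
    · exact if_neg fun h => h2 j (Finset.mem_range.1 hj) h.1
    · refine Finset.sum_congr rfl fun j _ => ?_
      have e : (t + s < dep n μ θ d (countBefore s d + p + j) ∧
          Nat.count (fun j => t + s < dep n μ θ d j) (countBefore s d + p + j) = i) ↔
          (t < dep n μ θ d' (p + j) ∧ Nat.count (fun j => t < dep n μ θ d' j) (p + j) = i) := by
        rw [h3, hcount]
      refine if_congr (by convert e) (if_congr Iff.rfl ?_ (hS j)) rfl
      rw [hdep, ← hd']
      ring

end Regeneration

/-- The conditions on an initial state. -/
def ValidState (n : ℕ) (μ θ : ℝ) (e : InitState) : Prop :=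
  (∀ k, k < n → k < e.1 → 0 < e.2.2 k) ∧ (∀ k, n ≤ k → k < e.1 → 0 ≤ e.2.1 k) ∧
  (∀ k, n ≤ k → k < e.1 → e.2.1 k < μ * e.2.2 k / θ) ∧
  (∀ k, n ≤ k → k + 1 < e.1 → e.2.1 (k + 1) ≤ e.2.1 k)

theorem Good.validState (hd : Good d) (hn : 1 ≤ n) (s : ℝ) :
    ValidState n μ θ (state n μ θ s d) := by
  classical
  set pos := Nat.count (fun j => s < dep n μ θ d j) with hpos
  have hK : (state n μ θ s d).1 = pos (countBefore s d) := by
    simp only [state, stateAt, hpos]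
  have hex : ∀ k < (state n μ θ s d).1, ∃ m < countBefore s d, s < dep n μ θ d m ∧ pos m = k := by
    intro k hk
    rw [hK] at hk
    have hfin : ∀ hf : {j | s < dep n μ θ d j}.Finite, k < hf.toFinset.card := fun hf =>
      lt_of_lt_of_le hk (by
        rw [hpos, Nat.count_eq_card_filter_range]
        refine Finset.card_le_card fun j hj => ?_
        rw [Set.Finite.mem_toFinset]
        exact (Finset.mem_filter.1 hj).2)
    refine ⟨Nat.nth (fun j => s < dep n μ θ d j) k, Nat.nth_lt_of_lt_count hk,
      Nat.nth_mem k hfin, Nat.count_nth hfin⟩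
  refine ⟨?_, ?_, ?_, ?_⟩
  · intro k hkn hk
    obtain ⟨m, hm, hs, rfl⟩ := hex k hk
    have hv : (state n μ θ s d).2.2 (pos m) = _ := stateAt_svc hm hs
    rw [hv, if_pos hkn]
    linarith
  · intro k hkn hk
    obtain ⟨m, hm, hs, rfl⟩ := hex k hk
    have hw : (state n μ θ s d).2.1 (pos m) = _ := stateAt_wait hm hs
    rw [hw]
    linarith [(hd.lt_countBefore_iff s m).1 hm]
  · intro k hkn hk
    obtain ⟨m, hm, hs, rfl⟩ := hex k hk
    have hw : (state n μ θ s d).2.1 (pos m) = _ := stateAt_wait hm hs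
    have hv : (state n μ θ s d).2.2 (pos m) = _ := stateAt_svc hm hs
    have hA := (hd.lt_countBefore_iff s m).1 hm
    rw [hw, hv, if_neg (not_lt.2 hkn)]
    -- With at least `n` predecessors still present, the customer has not been admitted by time `s`;
    -- as he has not left either, his patience exceeds the time waited.
    have hwait : ¬ wait n μ θ (arrivals d) (reqs d) m ≤ s - arrivals d m := by
      unfold wait
      rw [offeredWait_le_iff_count hn _ _ _ (by linarith), add_sub_cancel, not_lt]
      exact hkn
    change s < departure n μ θ (arrivals d) (reqs d) m at hs
    rw [departure_eq] at hs
    split_ifs at hs with h <;> linarith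
  · intro k hkn hk
    obtain ⟨m, hm, hs, hmk⟩ := hex k (by omega)
    obtain ⟨m', hm', hs', hmk'⟩ := hex (k + 1) hk
    have hw : (state n μ θ s d).2.1 (pos m) = _ := stateAt_wait hm hs
    have hw' : (state n μ θ s d).2.1 (pos m') = _ := stateAt_wait hm' hs'
    rw [← hmk', hw', ← hmk, hw]
    have hle : m ≤ m' := by
      by_contra hlt
      have := Nat.count_monotone (fun j => s < dep n μ θ d j) (not_le.1 hlt).le
      change pos m' ≤ pos m at this
      omega
    linarith [hd.strictMono.monotone hle]

end Noise

/-! ### Measurability -/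

section Measurability

variable {Ω : Type*} [MeasurableSpace Ω]

theorem measurable_apply_nat {β : Type*} [MeasurableSpace β] {g : ℕ → Ω → β} {k : Ω → ℕ}
    (hg : ∀ i, Measurable (g i)) (hk : Measurable k) : Measurable fun ω => g (k ω) ω := by
  have h : Measurable fun p : ℕ × Ω => g p.1 p.2 := measurable_from_prod_countable_right hg
  exact h.comp (hk.prodMk measurable_id)

/-- Counting measure is a countable sum of indicators. The value `0` of `ncard` on infinite sets is
what `toReal` makes of `⊤`. -/
theorem measurable_ncard {S : Ω → Set ℕ} (hS : ∀ m, MeasurableSet {ω | m ∈ S ω}) :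
    Measurable fun ω => (S ω).ncard := by
  classical
  have h1 : Measurable fun ω => Measure.count (S ω) := by
    have : (fun ω => Measure.count (S ω)) = fun ω => ∑' m, if m ∈ S ω then (1 : ENNReal) else 0 := by
      funext ω
      rw [Measure.count, Measure.sum_apply _ (MeasurableSet.of_discrete)]
      refine tsum_congr fun m => ?_
      rw [Measure.dirac_apply]
      simp [Set.indicator_apply]
    rw [this]
    exact Measurable.tsum fun m => Measurable.ite (hS m) measurable_const measurable_const
  have h2 : ∀ ω, ((S ω).ncard : ℝ) = (Measure.count (S ω)).toReal := by
    intro ω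
    by_cases hfin : (S ω).Finite
    · rw [Measure.count_apply_finite _ hfin, Set.ncard_eq_toFinset_card _ hfin]
      simp
    · rw [Measure.count_apply_infinite hfin, Set.Infinite.ncard hfin]
      simp
  have h3 : Measurable fun ω => ((S ω).ncard : ℝ) := by
    simp only [h2]
    exact h1.ennreal_toReal
  refine measurable_to_countable' fun k => ?_
  have : (fun ω => (S ω).ncard) ⁻¹' {k} = (fun ω => ((S ω).ncard : ℝ)) ⁻¹' {(k : ℝ)} := by
    ext ω
    simp
  rw [this]
  exact h3 (measurableSet_singleton _)

theorem measurable_count {p : Ω → ℕ → Prop} [∀ ω, DecidablePred (p ω)]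
    (hp : ∀ j, MeasurableSet {ω | p ω j}) (m : ℕ) : Measurable fun ω => Nat.count (p ω) m := by
  induction m with
  | zero => simp only [Nat.count_zero]; exact measurable_const
  | succ m ih =>
    simp only [Nat.count_succ]
    exact ih.add (Measurable.ite (hp m) measurable_const measurable_const)

variable {n : ℕ} {μ θ : ℝ}

/-- Sublevel sets of the wait are count conditions on the earlier departures, so strong induction
applies despite the infimum. -/
theorem measurable_departure (hn : 1 ≤ n) {arr svc : Ω → ℕ → ℝ}
    (harr : ∀ m, Measurable fun ω => arr ω m) (hsvc : ∀ m, Measurable fun ω => svc ω m) (m : ℕ) :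
    Measurable fun ω => departure n μ θ (arr ω) (svc ω) m := by
  classical
  induction m using Nat.strong_induction_on with
  | _ m ih =>
    have hw : Measurable fun ω => wait n μ θ (arr ω) (svc ω) m := by
      refine measurable_of_Iic fun w => ?_
      rcases lt_or_ge w 0 with hw | hw
      · convert MeasurableSet.empty
        ext ω
        simp only [Set.mem_preimage, Set.mem_Iic, Set.mem_empty_iff_false, iff_false, not_le]
        exact hw.trans_le (offeredWait_nonneg _ _ _)
      · have e : (fun ω => wait n μ θ (arr ω) (svc ω) m) ⁻¹' Set.Iic w =
            {ω | {j : ℕ | j < m ∧ arr ω m + w < departure n μ θ (arr ω) (svc ω) j}.ncard < n} := by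
          ext ω
          simp only [Set.mem_preimage, Set.mem_Iic, Set.mem_ofPred_eq]
          unfold wait
          rw [offeredWait_le_iff_count hn _ _ _ hw, Nat.count_eq_card_filter_range,
            ← Set.ncard_coe_finset]
          simp only [Finset.coe_filter, Finset.mem_range]
        rw [e]
        refine measurableSet_lt (measurable_ncard fun j => ?_) measurable_const
        by_cases hj : j < m
        · simp only [Set.mem_ofPred_eq, hj, true_and]
          exact measurableSet_lt ((harr m).add_const w) (ih j hj)
        · simp [hj]
    simp only [departure_eq n μ θ _ _ m]
    exact Measurable.ite (measurableSet_le hw (((hsvc m).const_mul μ).div_const θ))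
      (((harr m).add hw).add (hsvc m)) ((harr m).add (((hsvc m).const_mul μ).div_const θ))

theorem measurable_numberInSystem (hn : 1 ≤ n) {arr svc : Ω → ℕ → ℝ}
    (harr : ∀ m, Measurable fun ω => arr ω m) (hsvc : ∀ m, Measurable fun ω => svc ω m) (t : ℝ) :
    Measurable fun ω => numberInSystem n μ θ (arr ω) (svc ω) t := by
  refine measurable_ncard fun m => ?_
  exact (measurableSet_le (harr m) measurable_const).inter
    (measurableSet_lt measurable_const (measurable_departure hn harr hsvc m))

theorem measurable_arrivals (m : ℕ) : Measurable fun d : Noise => arrivals d m :=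
  Finset.measurable_sum _ fun i _ => measurable_pi_apply (Sum.inl i)

theorem measurable_reqs (m : ℕ) : Measurable fun d : Noise => reqs d m :=
  measurable_pi_apply (Sum.inr m)

theorem measurable_dep (hn : 1 ≤ n) (m : ℕ) : Measurable fun d : Noise => dep n μ θ d m :=
  measurable_departure hn measurable_arrivals measurable_reqs m

theorem measurable_emptyPath (hn : 1 ≤ n) : Measurable (emptyPath n μ θ) :=
  measurable_pi_iff.2 fun t => measurable_numberInSystem hn measurable_arrivals measurable_reqs t

theorem measurable_pathFrom (hn : 1 ≤ n) : Measurable (pathFrom n μ θ) := by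
  refine measurable_pi_iff.2 fun t => measurable_numberInSystem hn (fun m => ?_) (fun m => ?_) t
  · refine measurable_apply_nat (k := fun x : InitState × Noise => x.1.1)
      (g := fun k x => if m < k then (if m < n then 0 else -x.1.2.1 m)
        else ∑ i ∈ Finset.range (m - k + 1), x.2 (Sum.inl i)) (fun k => ?_) (by fun_prop)
    split_ifs <;> fun_prop
  · refine measurable_apply_nat (k := fun x : InitState × Noise => x.1.1)
      (g := fun k x => if m < k then x.1.2.2 m else x.2 (Sum.inr (m - k))) (fun k => ?_)
      (by fun_prop)
    split_ifs <;> fun_prop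

theorem measurable_countBefore (s : ℝ) : Measurable (countBefore s) := by
  have h : ∀ i, MeasurableSet {d : Noise | s < arrivals d i} := fun i =>
    measurableSet_lt measurable_const (measurable_arrivals i)
  refine measurable_of_Ici fun k => ?_
  -- The second factor accounts for noises with no arrival after `s`, where the infimum takes the
  -- default value `0`.
  have e : countBefore s ⁻¹' Set.Ici k =
      (⋂ i < k, {d : Noise | s < arrivals d i}ᶜ) ∩
        ({d : Noise | k = 0} ∪ ⋃ i, {d : Noise | s < arrivals d i}) := by
    ext d
    simp only [Set.mem_preimage, Set.mem_Ici, Set.mem_inter_iff, Set.mem_iInter, Set.mem_compl_iff,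
      Set.mem_ofPred_eq, Set.mem_union, Set.mem_iUnion]
    constructor
    · intro hk
      refine ⟨fun i hi hs => ?_, ?_⟩
      · exact absurd (Nat.sInf_le (show i ∈ {i | s < arrivals d i} from hs))
          (not_le.2 (lt_of_lt_of_le hi hk))
      · rcases Nat.eq_zero_or_pos k with h0 | h0
        · exact Or.inl h0
        · right
          by_contra hne
          have : {i | s < arrivals d i} = ∅ := by
            ext i
            simpa using fun h => hne ⟨i, h⟩
          rw [countBefore, this, Nat.sInf_empty] at hk
          omega
    · rintro ⟨h1, rfl | h2⟩
      · exact Nat.zero_le _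
      · by_contra hlt
        exact h1 _ (not_le.1 hlt) (Nat.sInf_mem (s := {i | s < arrivals d i}) h2)
  rw [e]
  exact (MeasurableSet.iInter fun i => MeasurableSet.iInter fun _ => (h i).compl).inter
    ((MeasurableSet.const _).union (MeasurableSet.iUnion h))

theorem measurable_shiftNoise (k : ℕ) {u : Ω → ℝ} {f : Ω → Noise} (hu : Measurable u)
    (hf : Measurable f) : Measurable fun ω => shiftNoise k (u ω) (f ω) := by
  refine measurable_pi_iff.2 fun i => ?_
  rcases i with i | i
  · simp only [shiftNoise, Sum.elim_inl]
    refine (measurable_pi_iff.1 hf _).sub ?_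
    split_ifs
    · exact hu
    · exact measurable_const
  · exact measurable_pi_iff.1 hf _

theorem measurable_restartNoise (s : ℝ) : Measurable (restartNoise s) := by
  have h : ∀ k, Measurable fun d : Noise =>
      shiftNoise k (s - ∑ i ∈ Finset.range k, d (Sum.inl i)) d := fun k =>
    measurable_shiftNoise k
      (measurable_const.sub (Finset.measurable_sum _ fun i _ => measurable_pi_apply (Sum.inl i)))
      measurable_id
  exact measurable_apply_nat h (measurable_countBefore s)

theorem measurable_stateAt (hn : 1 ≤ n) (s : ℝ) (k : ℕ) : Measurable (stateAt n μ θ s k) := by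
  classical
  have h1 : ∀ j, MeasurableSet {d : Noise | s < dep n μ θ d j} := fun j =>
    measurableSet_lt measurable_const (measurable_dep hn j)
  have h2 : ∀ m, Measurable fun d : Noise => Nat.count (fun j => s < dep n μ θ d j) m :=
    fun m => measurable_count h1 m
  have h3 : ∀ m i, MeasurableSet {d : Noise | s < dep n μ θ d m ∧
      Nat.count (fun j => s < dep n μ θ d j) m = i} :=
    fun m i => (h1 m).inter (measurableSet_eq_fun (h2 m) measurable_const)
  unfold stateAt
  refine Measurable.prodMk ?_ (Measurable.prodMk ?_ ?_)
  · convert h2 k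
  · refine measurable_pi_iff.2 fun i => Finset.measurable_sum _ fun m _ => ?_
    exact Measurable.ite (by convert h3 m i) (measurable_const.sub (measurable_arrivals m))
      measurable_const
  · refine measurable_pi_iff.2 fun i => Finset.measurable_sum _ fun m _ => ?_
    exact Measurable.ite (by convert h3 m i)
      (Measurable.ite (.const _) ((measurable_dep hn m).sub measurable_const) (measurable_reqs m))
      measurable_const

theorem measurable_state (hn : 1 ≤ n) (s : ℝ) : Measurable (state n μ θ s) :=
  measurable_apply_nat (measurable_stateAt hn s) (measurable_countBefore s)

theorem measurableSet_isRegen (c : ℝ) (i : ℕ) : MeasurableSet {d : Noise | IsRegen c d i} := by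
  have : {d : Noise | IsRegen c d i} =
      ⋂ j < i, {d : Noise | arrivals d j + c * reqs d j ≤ arrivals d i} := by
    ext d
    simp [IsRegen]
  rw [this]
  exact MeasurableSet.iInter fun j => MeasurableSet.iInter fun _ =>
    measurableSet_le ((measurable_arrivals j).add ((measurable_reqs j).const_mul c))
      (measurable_arrivals i)

theorem measurableSet_validState : MeasurableSet {e : InitState | ValidState n μ θ e} := by
  rw [measurableSet_setOfPred]
  refine .and (.forall fun k => .imp measurable_const (.imp ?_ ?_)) (.and
    (.forall fun k => .imp measurable_const (.imp ?_ ?_)) (.and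
    (.forall fun k => .imp measurable_const (.imp ?_ ?_))
    (.forall fun k => .imp measurable_const (.imp ?_ ?_))))
  all_goals
    rw [← measurableSet_setOfPred]
    first
    | exact measurableSet_lt (by fun_prop) (by fun_prop)
    | exact measurableSet_le (by fun_prop) (by fun_prop)

end Measurability

/-! ### The exponential distribution -/

section Exponential

theorem expMeasure_apply (r : ℝ) {B : Set ℝ} (hB : MeasurableSet B) :
    expMeasure r B = ∫⁻ x, B.indicator (exponentialPDF r) x := by
  rw [expMeasure, gammaMeasure, withDensity_apply _ hB, lintegral_indicator hB]
  rfl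

theorem measurable_exponentialPDF (r : ℝ) : Measurable (exponentialPDF r) :=
  (measurable_exponentialPDFReal r).ennreal_ofReal

/-- The exponential distribution has no memory. -/
theorem expMeasure_memoryless (r : ℝ) {u : ℝ} (hu : 0 ≤ u) {B : Set ℝ} (hB : MeasurableSet B) :
    expMeasure r {x | u < x ∧ x - u ∈ B} = ENNReal.ofReal (Real.exp (-(r * u))) * expMeasure r B := by
  have hS : MeasurableSet {x : ℝ | u < x ∧ x - u ∈ B} :=
    measurableSet_Ioi.inter ((measurable_id.sub_const u) hB)
  rw [expMeasure_apply r hS, expMeasure_apply r hB,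
    ← lintegral_const_mul _ ((measurable_exponentialPDF r).indicator hB),
    ← lintegral_add_right_eq_self _ u]
  refine lintegral_congr_ae ?_
  -- At `x = 0` the strict inequality `u < x + u` fails although the density does not vanish there.
  have h0 : ∀ᵐ x : ℝ, x ≠ 0 := by simp [ae_iff]
  filter_upwards [h0] with x hx
  rcases lt_or_gt_of_ne hx with hlt | hgt
  · rw [Set.indicator_of_notMem (by rintro ⟨h, _⟩; linarith)]
    by_cases hxB : x ∈ B
    · rw [Set.indicator_of_mem hxB, exponentialPDF_of_neg hlt, mul_zero]
    · rw [Set.indicator_of_notMem hxB, mul_zero]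
  · by_cases hxB : x ∈ B
    · rw [Set.indicator_of_mem hxB, Set.indicator_of_mem (by
        refine ⟨by linarith, ?_⟩; simpa using hxB), exponentialPDF_of_nonneg hgt.le,
        exponentialPDF_of_nonneg (by linarith), ← ENNReal.ofReal_mul (Real.exp_pos _).le]
      congr 1
      rw [mul_add, neg_add, Real.exp_add]
      ring
    · rw [Set.indicator_of_notMem hxB, mul_zero, Set.indicator_of_notMem]
      rintro ⟨_, h⟩
      exact hxB (by simpa using h)

/-- The case `u = 0` of memorylessness, where the inequality is strict. -/
theorem ae_pos_expMeasure {r : ℝ} (hr : 0 < r) : ∀ᵐ x ∂(expMeasure r), 0 < x := by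
  have := isProbabilityMeasure_expMeasure hr
  have h := expMeasure_memoryless r le_rfl MeasurableSet.univ
  have e : {x : ℝ | 0 < x ∧ x - 0 ∈ Set.univ} = {x : ℝ | 0 < x} := by ext; simp
  rw [e, mul_zero, neg_zero, Real.exp_zero, ENNReal.ofReal_one, measure_univ, one_mul] at h
  exact mem_ae_iff_prob_eq_one measurableSet_Ioi |>.2 h

theorem expMeasure_Ioi_pos {r : ℝ} (hr : 0 < r) {u : ℝ} (hu : 0 ≤ u) :
    0 < expMeasure r (Set.Ioi u) := by
  have := isProbabilityMeasure_expMeasure hr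
  have h := expMeasure_memoryless r hu MeasurableSet.univ
  have e : {x : ℝ | u < x ∧ x - u ∈ Set.univ} = Set.Ioi u := by ext; simp
  rw [e, measure_univ, mul_one] at h
  rw [h, ENNReal.ofReal_pos]
  exact Real.exp_pos _

/-- Exponential tilting: the integrand is `r / (r - t)` times the exponential density of rate `r -
t`. -/
theorem lintegral_exp_expMeasure {r t : ℝ} (hr : 0 < r) (ht : t < r) :
    ∫⁻ x, ENNReal.ofReal (Real.exp (t * x)) ∂(expMeasure r) = ENNReal.ofReal (r / (r - t)) := by
  have hrt : 0 < r - t := by linarith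
  have h1 : ∫⁻ x, ENNReal.ofReal (Real.exp (t * x)) ∂(expMeasure r) =
      ∫⁻ x, exponentialPDF r x * ENNReal.ofReal (Real.exp (t * x)) :=
    lintegral_withDensity_eq_lintegral_mul _ (measurable_exponentialPDF r) (by fun_prop)
  have h2 : ∀ x, exponentialPDF r x * ENNReal.ofReal (Real.exp (t * x)) =
      ENNReal.ofReal (r / (r - t)) * exponentialPDF (r - t) x := by
    intro x
    rcases lt_or_ge x 0 with hx | hx
    · rw [exponentialPDF_of_neg hx, exponentialPDF_of_neg hx, zero_mul, mul_zero]
    · rw [exponentialPDF_of_nonneg hx, exponentialPDF_of_nonneg hx,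
        ← ENNReal.ofReal_mul (by positivity), ← ENNReal.ofReal_mul (by positivity)]
      congr 1
      rw [mul_assoc, ← Real.exp_add, ← mul_assoc, div_mul_cancel₀ _ hrt.ne']
      congr 2
      ring
  rw [h1]
  simp only [h2]
  rw [lintegral_const_mul _ (measurable_exponentialPDF _), lintegral_exponentialPDF_eq_one hrt,
    mul_one]

end Exponential

/-! ### The law of the noise -/

/-- The laws of the interarrival times and of the service requirements. -/
noncomputable def coordLaw (lam μ : ℝ) : ℕ ⊕ ℕ → Measure ℝ :=
  Sum.elim (fun _ => expMeasure lam) (fun _ => expMeasure μ)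

instance isProbabilityMeasure_coordLaw (lam μ : ℝ) [hlam : Fact (0 < lam)] [hμ : Fact (0 < μ)]
    (i : ℕ ⊕ ℕ) : IsProbabilityMeasure (coordLaw lam μ i) := by
  rcases i with i | i
  · exact isProbabilityMeasure_expMeasure hlam.out
  · exact isProbabilityMeasure_expMeasure hμ.out

section NoiseLaw

variable (lam μ : ℝ) [hlam : Fact (0 < lam)] [hμ : Fact (0 < μ)]

/-- The law of the noise: independent exponential interarrival times and requirements. -/
noncomputable def noiseLaw : Measure Noise := Measure.infinitePi (coordLaw lam μ)

instance isProbabilityMeasure_noiseLaw : IsProbabilityMeasure (noiseLaw lam μ) := by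
  unfold noiseLaw
  infer_instance

variable {lam μ}

theorem map_eval_noiseLaw (i : ℕ ⊕ ℕ) :
    (noiseLaw lam μ).map (fun d => d i) = coordLaw lam μ i :=
  Measure.infinitePi_map_eval _ i

theorem iIndepFun_eval_noiseLaw :
    iIndepFun (fun (i : ℕ ⊕ ℕ) (d : Noise) => d i) (noiseLaw lam μ) :=
  iIndepFun_infinitePi (P := coordLaw lam μ) (X := fun _ x => x) fun _ => measurable_id

theorem ae_pos_noiseLaw : ∀ᵐ d ∂(noiseLaw lam μ), ∀ i, 0 < d i := by
  rw [ae_all_iff]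
  intro i
  have h : ∀ᵐ x ∂((noiseLaw lam μ).map (fun d => d i)), 0 < x := by
    rw [map_eval_noiseLaw]
    rcases i with i | i
    · exact ae_pos_expMeasure hlam.out
    · exact ae_pos_expMeasure hμ.out
  exact ae_of_ae_map (measurable_pi_apply i).aemeasurable h

/-- An exponential bound for the probability that a requirement exceeds a sum of interarrival
times. -/
theorem noiseLaw_sum_lt_le {c : ℝ} (hc : 0 < c) (y : ℝ) (J : Finset ℕ) (j : ℕ) :
    noiseLaw lam μ {d | y + ∑ l ∈ J, d (Sum.inl l) < c * d (Sum.inr j)} ≤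
      ENNReal.ofReal (2 * Real.exp (-(μ / (2 * c) * y))) *
        ENNReal.ofReal (lam / (lam + μ / (2 * c))) ^ J.card := by
  classical
  have hlam' := hlam.out
  have hμ' := hμ.out
  -- The Chernoff exponent. Since `β * c = μ / 2` is below the rate `μ`, the requirement contributes
  -- the factor `2`, and each gap contributes `lam / (lam + β)`.
  set β := μ / (2 * c) with hβ
  have hβ0 : 0 < β := by positivity
  have hβc : β * c = μ / 2 := by rw [hβ]; field_simp
  set f : ℕ ⊕ ℕ → ℝ → ENNReal := Sum.elim (fun _ x => ENNReal.ofReal (Real.exp (-β * x)))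
    (fun _ x => ENNReal.ofReal (Real.exp (μ / 2 * x))) with hf
  have hfm : ∀ i, Measurable (f i) := by
    rintro (i | i)
    · exact (by fun_prop : Measurable fun x : ℝ => ENNReal.ofReal (Real.exp (-β * x)))
    · exact (by fun_prop : Measurable fun x : ℝ => ENNReal.ofReal (Real.exp (μ / 2 * x)))
  set I : Finset (ℕ ⊕ ℕ) := insert (Sum.inr j) (J.map ⟨Sum.inl, Sum.inl_injective⟩) with hI
  have hnot : Sum.inr j ∉ J.map (⟨Sum.inl, Sum.inl_injective⟩ : ℕ ↪ ℕ ⊕ ℕ) := by simp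
  have hprod : ∀ d : Noise, ∏ i ∈ I, f i (d i) =
      ENNReal.ofReal (Real.exp (μ / 2 * d (Sum.inr j) - β * ∑ l ∈ J, d (Sum.inl l))) := by
    intro d
    rw [hI, Finset.prod_insert hnot, Finset.prod_map]
    simp only [hf, Sum.elim_inr, Sum.elim_inl, Function.Embedding.coeFn_mk]
    rw [← ENNReal.ofReal_prod_of_nonneg (fun _ _ => (Real.exp_pos _).le), ← Real.exp_sum,
      ← ENNReal.ofReal_mul (Real.exp_pos _).le, ← Real.exp_add, ← Finset.mul_sum]
    congr 2
    ring
  have hint : ∫⁻ d, ∏ i ∈ I, f i (d i) ∂(noiseLaw lam μ) =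
      ENNReal.ofReal 2 * ENNReal.ofReal (lam / (lam + β)) ^ J.card := by
    have h1 : ∫⁻ d, ∏ i ∈ I, f i (d i) ∂(noiseLaw lam μ) =
        ∏ i ∈ I, ∫⁻ d, f i (d i) ∂(noiseLaw lam μ) :=
      lintegral_prod_eq_prod_lintegral_of_indepFun I (fun i (d : Noise) => f i (d i))
        (iIndepFun_eval_noiseLaw.comp f hfm) (fun i => (hfm i).comp (measurable_pi_apply i))
    have h2 : ∀ i, ∫⁻ d, f i (d i) ∂(noiseLaw lam μ) = ∫⁻ x, f i x ∂(coordLaw lam μ i) := by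
      intro i
      rw [← map_eval_noiseLaw i, lintegral_map (hfm i) (measurable_pi_apply i)]
    rw [h1]
    simp only [h2]
    rw [hI, Finset.prod_insert hnot, Finset.prod_map]
    simp only [hf, coordLaw, Sum.elim_inr, Sum.elim_inl, Function.Embedding.coeFn_mk]
    rw [lintegral_exp_expMeasure hμ' (by linarith), lintegral_exp_expMeasure hlam' (by linarith),
      Finset.prod_const]
    congr 2
    · field_simp; norm_num
    · rw [sub_neg_eq_add]
  have hpm : Measurable fun d : Noise => ∏ i ∈ I, f i (d i) :=
    Finset.measurable_fun_prod _ fun i _ => (hfm i).comp (measurable_pi_apply i)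
  calc noiseLaw lam μ {d | y + ∑ l ∈ J, d (Sum.inl l) < c * d (Sum.inr j)}
      ≤ noiseLaw lam μ {d | 1 ≤ ENNReal.ofReal (Real.exp (-(β * y))) * ∏ i ∈ I, f i (d i)} := by
        refine measure_mono fun d hd => ?_
        have hd' : y + ∑ l ∈ J, d (Sum.inl l) < c * d (Sum.inr j) := hd
        rw [Set.mem_ofPred_eq, hprod, ← ENNReal.ofReal_mul (Real.exp_pos _).le, ← Real.exp_add, ← ENNReal.ofReal_one]
        refine ENNReal.ofReal_le_ofReal (Real.one_le_exp ?_)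
        have := mul_lt_mul_of_pos_left hd' hβ0
        rw [← mul_assoc, hβc] at this
        nlinarith
    _ ≤ ∫⁻ d, ENNReal.ofReal (Real.exp (-(β * y))) * ∏ i ∈ I, f i (d i) ∂(noiseLaw lam μ) := by
        have := mul_meas_ge_le_lintegral (μ := noiseLaw lam μ)
          (f := fun d => ENNReal.ofReal (Real.exp (-(β * y))) * ∏ i ∈ I, f i (d i))
          (hpm.const_mul _) 1
        simpa using this
    _ = _ := by
        rw [lintegral_const_mul _ hpm, hint, ← mul_assoc,
            ← ENNReal.ofReal_mul (Real.exp_pos _).le, mul_comm 2]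

theorem ratio_lt_one {c : ℝ} (hc : 0 < c) :
    ENNReal.ofReal (lam / (lam + μ / (2 * c))) < 1 := by
  have hlam' := hlam.out
  have hμ' := hμ.out
  rw [ENNReal.ofReal_lt_one, div_lt_one (by positivity)]
  have : 0 < μ / (2 * c) := by positivity
  linarith

/-- If all arrival epochs stayed below `x`, every partial sum of gaps would be less than `x` plus a
positive requirement; the Chernoff bound with `y = -x` and `c = 1` makes this geometrically
unlikely. -/
theorem ae_good_noiseLaw : ∀ᵐ d ∂(noiseLaw lam μ), Good d := by
  have h : ∀ x : ℕ, ∀ᵐ d ∂(noiseLaw lam μ), ∃ i, (x : ℝ) < arrivals d i := by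
    intro x
    rw [ae_iff]
    have hle : ∀ i : ℕ, noiseLaw lam μ {d | ¬ ∃ i, (x : ℝ) < arrivals d i} ≤
        ENNReal.ofReal (2 * Real.exp (-(μ / (2 * 1) * (-x)))) *
        ENNReal.ofReal (lam / (lam + μ / (2 * 1))) ^ (i + 1) := by
      intro i
      have h1 := noiseLaw_sum_lt_le (lam := lam) (μ := μ) one_pos (-(x : ℝ)) (Finset.range (i + 1)) 0
      rw [Finset.card_range] at h1
      refine le_trans (measure_mono_ae ?_) h1
      filter_upwards [ae_pos_noiseLaw (lam := lam) (μ := μ)] with d hd hx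
      have hx' : arrivals d i ≤ x := not_lt.1 fun h => hx ⟨i, h⟩
      change -(x : ℝ) + arrivals d i < 1 * d (Sum.inr 0)
      linarith [hd (Sum.inr 0)]
    have htends : Tendsto (fun i : ℕ => ENNReal.ofReal (2 * Real.exp (-(μ / (2 * 1) * (-(x : ℝ))))) *
        ENNReal.ofReal (lam / (lam + μ / (2 * 1))) ^ (i + 1)) atTop (nhds 0) := by
      have h2 := (ENNReal.tendsto_pow_atTop_nhds_zero_of_lt_one
        (ratio_lt_one (lam := lam) (μ := μ) one_pos)).comp (tendsto_add_atTop_nat 1)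
      have := ENNReal.Tendsto.const_mul (a := ENNReal.ofReal (2 * Real.exp (-(μ / (2 * 1) * (-(x : ℝ)))))) h2
        (Or.inr ENNReal.ofReal_ne_top)
      simpa using this
    exact le_antisymm (ge_of_tendsto' htends hle) zero_le
  rw [← ae_all_iff] at h
  filter_upwards [h, ae_pos_noiseLaw (lam := lam) (μ := μ)] with d hd hpos
  refine ⟨hpos, tendsto_atTop_atTop_of_monotone (monotone_nat_of_le_succ fun m => ?_) fun b => ?_⟩
  · rw [arrivals_succ]
    linarith [hpos (Sum.inl (m + 1))]
  · obtain ⟨x, hx⟩ := exists_nat_ge b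
    obtain ⟨i, hi⟩ := hd x
    exact ⟨i, hx.trans hi.le⟩

/-! ### Memorylessness -/

theorem measurable_shiftNoise_const (k : ℕ) (u : ℝ) : Measurable (shiftNoise k u) :=
  measurable_shiftNoise k measurable_const measurable_id

/-- Only the first gap is shortened, so one-dimensional memorylessness lifts to the product, by
uniqueness of the product measure on finite boxes. -/
theorem noiseLaw_memoryless {u : ℝ} (hu : 0 ≤ u) {B : Set Noise} (hB : MeasurableSet B) :
    noiseLaw lam μ {d | u < d (Sum.inl 0) ∧ shiftNoise 0 u d ∈ B} =
      ENNReal.ofReal (Real.exp (-(lam * u))) * noiseLaw lam μ B := by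
  classical
  have hmeas := measurable_shiftNoise_const 0 u
  have hS : MeasurableSet {d : Noise | u < d (Sum.inl 0)} :=
    measurableSet_lt measurable_const (measurable_pi_apply _)
  set ν : Measure Noise := ENNReal.ofReal (Real.exp (lam * u)) •
    ((noiseLaw lam μ).restrict {d : Noise | u < d (Sum.inl 0)}).map (shiftNoise 0 u) with hν
  have hexp : ENNReal.ofReal (Real.exp (lam * u)) * ENNReal.ofReal (Real.exp (-(lam * u))) = 1 := by
    rw [← ENNReal.ofReal_mul (Real.exp_pos _).le, ← Real.exp_add]
    simp
  have happ : ∀ B : Set Noise, MeasurableSet B → ν B = ENNReal.ofReal (Real.exp (lam * u)) *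
      noiseLaw lam μ {d | u < d (Sum.inl 0) ∧ shiftNoise 0 u d ∈ B} := by
    intro B hB
    rw [hν, Measure.smul_apply, smul_eq_mul, Measure.map_apply hmeas hB,
      Measure.restrict_apply (hmeas hB)]
    congr 2
    ext d
    exact and_comm
  have hνeq : ν = noiseLaw lam μ := by
    refine Measure.eq_infinitePi _ fun s t ht => ?_
    rw [happ _ (MeasurableSet.pi s.countable_toSet fun i _ => ht i)]
    -- The condition `u < d (Sum.inl 0)` constrains the first gap even if the box does not, so that
    -- coordinate is always added to the box.
    set t' : ℕ ⊕ ℕ → Set ℝ := fun i => if i = Sum.inl 0 then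
      {x | u < x ∧ x - u ∈ (if Sum.inl 0 ∈ s then t (Sum.inl 0) else Set.univ)} else t i with ht'
    have hm0 : MeasurableSet (if Sum.inl 0 ∈ s then t (Sum.inl 0) else Set.univ : Set ℝ) := by
      split_ifs
      · exact ht _
      · exact MeasurableSet.univ
    have e : {d : Noise | u < d (Sum.inl 0) ∧ shiftNoise 0 u d ∈ Set.pi (s : Set (ℕ ⊕ ℕ)) t} =
        Set.pi (insert (Sum.inl 0) (s.erase (Sum.inl 0)) : Finset (ℕ ⊕ ℕ)) t' := by
      ext d
      have hco : ∀ i, i ≠ Sum.inl 0 → shiftNoise 0 u d i = d i := by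
        rintro (i | i) hi
        · have : i ≠ 0 := fun h => hi (by rw [h])
          simp [shiftNoise, this]
        · simp [shiftNoise]
      have hc0 : shiftNoise 0 u d (Sum.inl 0) = d (Sum.inl 0) - u := by simp [shiftNoise]
      simp only [Set.mem_ofPred_eq, Set.mem_pi, Finset.coe_insert, Set.mem_insert_iff,
        Finset.mem_coe, Finset.mem_erase]
      constructor
      · rintro ⟨h1, h2⟩ i (rfl | ⟨hi, his⟩)
        · simp only [ht', if_true]
          refine ⟨h1, ?_⟩
          split_ifs with h
          · rw [← hc0]; exact h2 _ h
          · trivial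
        · simp only [ht', if_neg hi]
          rw [← hco i hi]
          exact h2 i his
      · intro h
        have h0 := h (Sum.inl 0) (Or.inl rfl)
        simp only [ht', if_true] at h0
        refine ⟨h0.1, fun i hi => ?_⟩
        by_cases hi0 : i = Sum.inl 0
        · subst hi0
          have := h0.2
          rw [if_pos hi] at this
          rw [hc0]
          exact this
        · have := h i (Or.inr ⟨hi0, hi⟩)
          simp only [ht', if_neg hi0] at this
          rw [hco i hi0]
          exact this
    have hmt' : ∀ i, MeasurableSet (t' i) := by
      intro i
      simp only [ht']
      split_ifs
      all_goals first
        | exact ht i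
        | exact measurableSet_Ioi.inter ((measurable_id.sub_const u) (ht _))
        | exact measurableSet_Ioi.inter ((measurable_id.sub_const u) MeasurableSet.univ)
    rw [e, noiseLaw, Measure.infinitePi_pi _ (fun i _ => hmt' i),
      Finset.prod_insert (Finset.notMem_erase _ _)]
    have h0 : coordLaw lam μ (Sum.inl 0) (t' (Sum.inl 0)) =
        ENNReal.ofReal (Real.exp (-(lam * u))) *
          coordLaw lam μ (Sum.inl 0) (if Sum.inl 0 ∈ s then t (Sum.inl 0) else Set.univ) := by
      simp only [ht', if_true]
      exact expMeasure_memoryless lam hu hm0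
    have h1 : ∏ i ∈ s.erase (Sum.inl 0), coordLaw lam μ i (t' i) =
        ∏ i ∈ s.erase (Sum.inl 0), coordLaw lam μ i (t i) :=
      Finset.prod_congr rfl fun i hi => by
        simp only [ht', if_neg (Finset.ne_of_mem_erase hi)]
    rw [h0, h1, ← mul_assoc, ← mul_assoc, hexp, one_mul]
    split_ifs with h
    · rw [Finset.mul_prod_erase s (fun i => coordLaw lam μ i (t i)) h]
    · rw [measure_univ, one_mul, Finset.erase_eq_of_notMem h]
  rw [← hνeq, happ B hB, ← mul_assoc, mul_comm (ENNReal.ofReal (Real.exp (-(lam * u)))), hexp,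
    one_mul, hνeq]

/-- The customers with numbers below `k`. -/
noncomputable def headNoise (k : ℕ) (d : Noise) : Noise :=
  Sum.elim (fun i => if i < k then d (Sum.inl i) else 0) (fun i => if i < k then d (Sum.inr i) else 0)

theorem measurable_headNoise (k : ℕ) : Measurable (headNoise k) := by
  refine measurable_pi_iff.2 fun i => ?_
  rcases i with i | i
  all_goals
    simp only [headNoise, Sum.elim_inl, Sum.elim_inr]
    split_ifs
    · exact measurable_pi_apply _
    · exact measurable_const

theorem map_shiftNoise_zero (k : ℕ) : (noiseLaw lam μ).map (shiftNoise k 0) = noiseLaw lam μ := by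
  have hinj : Function.Injective (Sum.map (k + ·) (k + ·) : ℕ ⊕ ℕ → ℕ ⊕ ℕ) :=
    Function.Injective.sumMap (add_right_injective k) (add_right_injective k)
  have h := Measure.map_infinitePi_infinitePi_of_inj (P := coordLaw lam μ) hinj
  have e1 : (fun (d : Noise) i => d (Sum.map (k + ·) (k + ·) i)) = shiftNoise k 0 := by
    funext d i
    rcases i with i | i <;> simp [shiftNoise]
  have e2 : (fun i => coordLaw lam μ (Sum.map (k + ·) (k + ·) i)) = coordLaw lam μ := by
    funext i
    rcases i with i | i <;> rfl
  rw [e1] at h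
  simp only [e2] at h
  exact h

theorem indepFun_headNoise_shiftNoise (k : ℕ) :
    IndepFun (headNoise k) (shiftNoise k 0) (noiseLaw lam μ) := by
  set S : Set (ℕ ⊕ ℕ) := {i | Sum.elim id id i < k} with hS
  have hle : ∀ i : ℕ ⊕ ℕ, MeasurableSpace.comap (fun d : Noise => d i) inferInstance ≤
      (inferInstance : MeasurableSpace Noise) := fun i => (measurable_pi_apply i).comap_le
  have hind := indep_iSup_of_disjoint hle (iIndepFun_eval_noiseLaw (lam := lam) (μ := μ)).iIndep
    (disjoint_compl_right (a := S))
  have hev : ∀ (T : Set (ℕ ⊕ ℕ)) (i : ℕ ⊕ ℕ), i ∈ T →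
      Measurable[⨆ i ∈ T, MeasurableSpace.comap (fun d : Noise => d i) inferInstance]
        (fun d : Noise => d i) := by
    intro T i hi
    refine Measurable.mono (comap_measurable _) ?_ le_rfl
    exact le_iSup₂_of_le i hi le_rfl
  refine indep_of_indep_of_le_left (indep_of_indep_of_le_right hind ?_) ?_
  · refine Measurable.comap_le ?_
    refine (@measurable_pi_iff _ _ _ (_) _ _).2 ?_
    rintro (i | i)
    · simp only [shiftNoise, Sum.elim_inl, ite_self, sub_zero]
      exact hev _ _ (by simp [hS])
    · exact hev _ (Sum.inr (k + i)) (by simp [hS])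
  · refine Measurable.comap_le ?_
    refine (@measurable_pi_iff _ _ _ (_) _ _).2 ?_
    rintro (i | i)
    all_goals
      simp only [headNoise, Sum.elim_inl, Sum.elim_inr]
      split_ifs with h
      · exact hev _ _ (by simpa [hS] using h)
      · exact measurable_const

theorem map_headNoise_shiftNoise (k : ℕ) :
    (noiseLaw lam μ).map (fun d => (headNoise k d, shiftNoise k 0 d)) =
      ((noiseLaw lam μ).map (headNoise k)).prod (noiseLaw lam μ) := by
  have h := (indepFun_iff_map_prod_eq_prod_map_map (measurable_headNoise k).aemeasurable
    (measurable_shiftNoise_const k 0).aemeasurable).1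
    (indepFun_headNoise_shiftNoise (lam := lam) (μ := μ) k)
  rw [h, map_shiftNoise_zero]

end NoiseLaw

/-! ### Independence of past and future at a fixed time. -/

section Restart

variable {lam μ : ℝ} [hlam : Fact (0 < lam)] [hμ : Fact (0 < μ)]

theorem Good.countBefore_eq_iff {d : Noise} (hd : Good d) {s : ℝ} (hs : 0 ≤ s) (k : ℕ) :
    countBefore s d = k ↔ ∑ i ∈ Finset.range k, d (Sum.inl i) ≤ s ∧
      s - ∑ i ∈ Finset.range k, d (Sum.inl i) < d (Sum.inl k) := by
  have hA : arrivals d k = ∑ i ∈ Finset.range k, d (Sum.inl i) + d (Sum.inl k) :=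
    Finset.sum_range_succ _ _
  have h1 : countBefore s d ≤ k ↔ s - ∑ i ∈ Finset.range k, d (Sum.inl i) < d (Sum.inl k) := by
    rw [← not_lt, hd.lt_countBefore_iff, hA, not_le]
    constructor <;> intro _ <;> linarith
  have h2 : k ≤ countBefore s d ↔ ∑ i ∈ Finset.range k, d (Sum.inl i) ≤ s := by
    rcases k with _ | k
    · simpa using hs
    · exact hd.lt_countBefore_iff s k
  rw [← h1, ← h2]
  omega

/-- What has happened up to time `s` is independent of the noise seen from time `s` on, which
has the law of the noise. -/
theorem noiseLaw_restart {β : Type*} [MeasurableSpace β] {g : ℕ → Noise → β}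
    (hg : ∀ k, Measurable (g k)) (hghead : ∀ k d, g k (headNoise k d) = g k d) {s : ℝ} (hs : 0 ≤ s)
    {A : Set β} (hA : MeasurableSet A) {B : Set Noise} (hB : MeasurableSet B) :
    noiseLaw lam μ {d | g (countBefore s d) d ∈ A ∧ restartNoise s d ∈ B} =
      noiseLaw lam μ {d | g (countBefore s d) d ∈ A} * noiseLaw lam μ B := by
  set G : ℕ → Noise → ℝ := fun k d => ∑ i ∈ Finset.range k, d (Sum.inl i) with hG
  have hGm : ∀ k, Measurable (G k) := fun k =>
    Finset.measurable_sum _ fun i _ => measurable_pi_apply (Sum.inl i)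
  have hGhead : ∀ k d, G k (headNoise k d) = G k d := by
    intro k d
    refine Finset.sum_congr rfl fun i hi => ?_
    simp [headNoise, Finset.mem_range.1 hi]
  have hgm : Measurable fun d => g (countBefore s d) d :=
    measurable_apply_nat hg (measurable_countBefore s)
  -- If exactly `k` customers have come by `s`, the past is a function of the head and the future is
  -- the tail with its first gap shortened by `s - G k d`. Integrating memorylessness of the tail
  -- over the head gives a constant that does not depend on `B`; the sum of these constants is
  -- identified by `B = Set.univ`.
  have hpiece : ∀ k, ∃ c, ∀ B : Set Noise, MeasurableSet B →
      noiseLaw lam μ ({d | g (countBefore s d) d ∈ A ∧ restartNoise s d ∈ B} ∩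
        countBefore s ⁻¹' {k}) = c * noiseLaw lam μ B := by
    intro k
    set S : Set Noise := {h | G k h ≤ s ∧ g k h ∈ A} with hS
    have hSm : MeasurableSet S := (measurableSet_le (hGm k) measurable_const).inter (hg k hA)
    refine ⟨∫⁻ h, S.indicator (fun h => ENNReal.ofReal (Real.exp (-(lam * (s - G k h))))) h
      ∂((noiseLaw lam μ).map (headNoise k)), fun B hB => ?_⟩
    set T : Set (Noise × Noise) := {p | p.1 ∈ S ∧ s - G k p.1 < p.2 (Sum.inl 0) ∧
      shiftNoise 0 (s - G k p.1) p.2 ∈ B} with hT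
    have hu : Measurable fun p : Noise × Noise => s - G k p.1 :=
      measurable_const.sub ((hGm k).comp measurable_fst)
    have hTm : MeasurableSet T := by
      refine (measurable_fst hSm).inter (MeasurableSet.inter ?_ ?_)
      · exact measurableSet_lt hu ((measurable_pi_apply _).comp measurable_snd)
      · exact measurable_shiftNoise 0 hu measurable_snd hB
    have hpair : Measurable fun d : Noise => (headNoise k d, shiftNoise k 0 d) :=
      (measurable_headNoise k).prodMk (measurable_shiftNoise_const k 0)
    have hae : (({d | g (countBefore s d) d ∈ A ∧ restartNoise s d ∈ B} ∩
        countBefore s ⁻¹' {k} : Set Noise)) =ᵐ[noiseLaw lam μ]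
        ((fun d : Noise => (headNoise k d, shiftNoise k 0 d)) ⁻¹' T : Set Noise) := by
      rw [eventuallyEq_set]
      filter_upwards [ae_good_noiseLaw (lam := lam) (μ := μ)] with d hd
      have hshift : shiftNoise 0 (s - G k d) (shiftNoise k 0 d) = shiftNoise k (s - G k d) d := by
        funext i
        rcases i with i | i <;> simp [shiftNoise]
      have h0 : shiftNoise k 0 d (Sum.inl 0) = d (Sum.inl k) := by simp [shiftNoise]
      simp only [Set.mem_inter_iff, Set.mem_preimage, Set.mem_singleton_iff, hT, hS,
        Set.mem_ofPred_eq, hGhead, hghead, hshift, h0]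
      constructor
      · rintro ⟨⟨h1, h2⟩, h3⟩
        have h4 := (hd.countBefore_eq_iff hs k).1 h3
        rw [restartNoise, h3] at h2
        rw [h3] at h1
        exact ⟨⟨h4.1, h1⟩, h4.2, h2⟩
      · rintro ⟨⟨h1, h2⟩, h3, h4⟩
        have h5 := (hd.countBefore_eq_iff hs k).2 ⟨h1, h3⟩
        refine ⟨⟨by rwa [h5], ?_⟩, h5⟩
        rw [restartNoise, h5]
        exact h4
    rw [measure_congr hae, ← Measure.map_apply hpair hTm, map_headNoise_shiftNoise,
      Measure.prod_apply hTm, ← lintegral_mul_const]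
    · refine lintegral_congr fun h => ?_
      by_cases hhS : h ∈ S
      · rw [Set.indicator_of_mem hhS, ← noiseLaw_memoryless (sub_nonneg.2 hhS.1) hB]
        congr 1
        ext τ
        simp only [Set.mem_preimage, hT, Set.mem_ofPred_eq, hhS, true_and]
      · rw [Set.indicator_of_notMem hhS, zero_mul]
        convert measure_empty (μ := noiseLaw lam μ)
        ext τ
        simp only [Set.mem_preimage, hT, Set.mem_ofPred_eq, hhS, false_and, Set.mem_empty_iff_false]
    · exact Measurable.indicator (by have := hGm k; fun_prop) hSm
  choose c hc using hpiece
  have hsum : ∀ B : Set Noise, MeasurableSet B →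
      noiseLaw lam μ {d | g (countBefore s d) d ∈ A ∧ restartNoise s d ∈ B} =
        (∑' k, c k) * noiseLaw lam μ B := by
    intro B hB
    have hE : MeasurableSet {d | g (countBefore s d) d ∈ A ∧ restartNoise s d ∈ B} :=
      (hgm hA).inter (measurable_restartNoise s hB)
    rw [← ENNReal.tsum_mul_right]
    simp only [← hc _ B hB]
    rw [← measure_iUnion]
    · rw [← Set.inter_iUnion]
      congr 1
      symm
      rw [Set.inter_eq_left]
      intro d _
      simp
    · intro i j hij
      refine Set.disjoint_left.2 fun d h1 h2 => hij ?_
      rw [← (h1.2 : countBefore s d = i), ← (h2.2 : countBefore s d = j)]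
    · exact fun k => hE.inter (measurable_countBefore s (measurableSet_singleton k))
  have huniv := hsum Set.univ MeasurableSet.univ
  simp only [Set.mem_univ, and_true, measure_univ, mul_one] at huniv
  rw [hsum B hB, huniv]

theorem map_restartNoise {s : ℝ} (hs : 0 ≤ s) :
    (noiseLaw lam μ).map (restartNoise s) = noiseLaw lam μ := by
  ext B hB
  rw [Measure.map_apply (measurable_restartNoise s) hB]
  have h := noiseLaw_restart (lam := lam) (μ := μ) (g := fun _ _ => ()) (fun _ => measurable_const)
    (fun _ _ => rfl) hs MeasurableSet.univ hB
  simp only [Set.mem_univ, true_and] at h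
  have e : {d : Noise | True} = Set.univ := by ext; simp
  rw [e, measure_univ, one_mul] at h
  exact h

theorem measurePreserving_restartNoise {s : ℝ} (hs : 0 ≤ s) :
    MeasurePreserving (restartNoise s) (noiseLaw lam μ) (noiseLaw lam μ) :=
  ⟨measurable_restartNoise s, map_restartNoise hs⟩

/-- Under FIFO later customers do not influence earlier ones. This makes `stateAt` an admissible
functional of the past in `noiseLaw_restart`. -/
theorem stateAt_headNoise (n : ℕ) (μ θ s : ℝ) (k : ℕ) (d : Noise) :
    stateAt n μ θ s k (headNoise k d) = stateAt n μ θ s k d := by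
  classical
  have hA : ∀ m < k, arrivals (headNoise k d) m = arrivals d m := by
    intro m hm
    unfold arrivals
    refine Finset.sum_congr rfl fun i hi => ?_
    have : i < k := by have := Finset.mem_range.1 hi; omega
    simp [headNoise, this]
  have hR : ∀ m < k, reqs (headNoise k d) m = reqs d m := by
    intro m hm
    simp [reqs, headNoise, hm]
  have hD : ∀ m < k, dep n μ θ (headNoise k d) m = dep n μ θ d m := fun m hm =>
    departure_congr m fun j hj => ⟨hA j (lt_of_le_of_lt hj hm), hR j (lt_of_le_of_lt hj hm)⟩
  have hC : ∀ m ≤ k, Nat.count (fun j => s < dep n μ θ (headNoise k d) j) m =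
      Nat.count (fun j => s < dep n μ θ d j) m := by
    intro m hm
    rw [Nat.count_eq_card_filter_range, Nat.count_eq_card_filter_range]
    congr 1
    refine Finset.filter_congr fun j hj => ?_
    rw [hD j (lt_of_lt_of_le (Finset.mem_range.1 hj) hm)]
  unfold stateAt
  refine Prod.ext ?_ (Prod.ext ?_ ?_)
  · convert hC k le_rfl
  · funext i
    simp only
    refine Finset.sum_congr rfl fun m hm => ?_
    have hm' := Finset.mem_range.1 hm
    refine if_congr ?_ (by rw [hA m hm']) rfl
    rw [hD m hm']
    convert Iff.rfl using 3
    exact (hC m hm'.le).symm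
  · funext i
    simp only
    refine Finset.sum_congr rfl fun m hm => ?_
    have hm' := Finset.mem_range.1 hm
    refine if_congr ?_ (by rw [hD m hm', hR m hm']) rfl
    rw [hD m hm']
    convert Iff.rfl using 3
    exact (hC m hm'.le).symm

end Restart

/-! ### Recurrence -/

section Recurrence

variable {lam μ : ℝ} [hlam : Fact (0 < lam)] [hμ : Fact (0 < μ)]

theorem arrivals_eq_add_sum {d : Noise} {j i : ℕ} (hji : j < i) :
    arrivals d i = arrivals d j + (∑ l ∈ Finset.Ico (j + 1) i, d (Sum.inl l) + d (Sum.inl i)) := by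
  rw [arrivals, arrivals, Finset.sum_range_succ, ← add_assoc,
    Finset.sum_range_add_sum_Ico _ (by omega : j + 1 ≤ i)]

theorem measurableSet_sum_lt (c x : ℝ) (J : Finset ℕ) (j : ℕ) :
    MeasurableSet {d : Noise | x + ∑ l ∈ J, d (Sum.inl l) < c * d (Sum.inr j)} :=
  measurableSet_lt (measurable_const.add (Finset.measurable_sum _ fun _ _ => measurable_pi_apply _))
    ((measurable_reqs j).const_mul c)

/-- Customer `i` regenerates if the last gap exceeds `x` while every earlier customer would be gone
within `x` after the start of that gap. The Chernoff bounds for failure of the second event sum to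
at most `1 / 2` for a suitable `x`, uniformly in `i` thanks to the geometric series, and this event
is independent of the last gap. -/
theorem exists_le_noiseLaw_isRegen {c : ℝ} (hc : 0 < c) :
    ∃ p : ENNReal, 0 < p ∧ ∀ i, p ≤ noiseLaw lam μ {d | IsRegen c d i} := by
  have hμ' := hμ.out
  set r := ENNReal.ofReal (lam / (lam + μ / (2 * c))) with hr
  have hr1 : r < 1 := ratio_lt_one hc
  obtain ⟨x, hx0, hx⟩ : ∃ x : ℝ, 0 ≤ x ∧
      ENNReal.ofReal (2 * Real.exp (-(μ / (2 * c) * x))) * (1 - r)⁻¹ ≤ 2⁻¹ := by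
    have hβ : 0 < μ / (2 * c) := by positivity
    have h1 : Tendsto (fun x : ℝ => 2 * Real.exp (-(μ / (2 * c) * x))) atTop (nhds (2 * 0)) :=
      (Real.tendsto_exp_neg_atTop_nhds_zero.comp (tendsto_id.const_mul_atTop hβ)).const_mul 2
    have h2 := ENNReal.Tendsto.mul_const (b := (1 - r)⁻¹) (ENNReal.tendsto_ofReal h1)
      (Or.inr (ENNReal.inv_ne_top.2 (tsub_pos_of_lt hr1).ne'))
    rw [mul_zero, ENNReal.ofReal_zero, zero_mul] at h2
    have h3 := (h2.eventually (ge_mem_nhds (by simp : (0 : ENNReal) < 2⁻¹))).and (eventually_ge_atTop 0)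
    obtain ⟨x, hx1, hx2⟩ := h3.exists
    exact ⟨x, hx2, hx1⟩
  refine ⟨expMeasure lam (Set.Ioi x) * 2⁻¹, ENNReal.mul_pos
    (expMeasure_Ioi_pos hlam.out hx0).ne' (by simp), fun i => ?_⟩
  set Bad : Set Noise := ⋃ j ∈ Finset.range i,
    {d | x + ∑ l ∈ Finset.Ico (j + 1) i, d (Sum.inl l) < c * d (Sum.inr j)} with hBad
  have hBadm : MeasurableSet Bad :=
    Finset.measurableSet_biUnion _ fun j _ => measurableSet_sum_lt c x _ j
  have hBadle : noiseLaw lam μ Bad ≤ 2⁻¹ := by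
    refine le_trans ?_ hx
    calc noiseLaw lam μ Bad ≤ ∑ j ∈ Finset.range i, noiseLaw lam μ
          {d | x + ∑ l ∈ Finset.Ico (j + 1) i, d (Sum.inl l) < c * d (Sum.inr j)} :=
          measure_biUnion_finset_le _ _
      _ ≤ ∑ j ∈ Finset.range i,
          ENNReal.ofReal (2 * Real.exp (-(μ / (2 * c) * x))) * r ^ (i - 1 - j) := by
          refine Finset.sum_le_sum fun j _ => ?_
          have h := noiseLaw_sum_lt_le (lam := lam) (μ := μ) hc x (Finset.Ico (j + 1) i) j
          rw [Nat.card_Ico] at h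
          rwa [show i - 1 - j = i - (j + 1) by omega]
      _ = ENNReal.ofReal (2 * Real.exp (-(μ / (2 * c) * x))) * ∑ j ∈ Finset.range i, r ^ j := by
          rw [← Finset.mul_sum, Finset.sum_range_reflect (fun j => r ^ j)]
      _ ≤ _ := by
          gcongr
          rw [← ENNReal.tsum_geometric]
          exact ENNReal.sum_le_tsum _
  have hBadc : 2⁻¹ ≤ noiseLaw lam μ Badᶜ := by
    rw [prob_compl_eq_one_sub hBadm]
    calc (2⁻¹ : ENNReal) = 1 - 2⁻¹ := ENNReal.one_sub_inv_two.symm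
      _ ≤ _ := tsub_le_tsub_left hBadle 1
  have hhead : headNoise i ⁻¹' Badᶜ = Badᶜ := by
    ext d
    simp only [hBad, Set.mem_preimage, Set.mem_compl_iff, Set.mem_iUnion, not_exists,
      Set.mem_ofPred_eq, Finset.mem_range]
    refine forall₂_congr fun j hj => ?_
    have h1 : ∑ l ∈ Finset.Ico (j + 1) i, headNoise i d (Sum.inl l) =
        ∑ l ∈ Finset.Ico (j + 1) i, d (Sum.inl l) :=
      Finset.sum_congr rfl fun l hl => by simp [headNoise, (Finset.mem_Ico.1 hl).2]
    have h2 : headNoise i d (Sum.inr j) = d (Sum.inr j) := by simp [headNoise, hj]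
    rw [h1, h2]
  have hgap : MeasurableSet {d : Noise | x < d (Sum.inl 0)} :=
    measurableSet_lt measurable_const (measurable_pi_apply _)
  have hind := (indepFun_headNoise_shiftNoise (lam := lam) (μ := μ) i).measure_inter_preimage_eq_mul
    Badᶜ {d : Noise | x < d (Sum.inl 0)} hBadm.compl hgap
  have hlaw : noiseLaw lam μ (shiftNoise i 0 ⁻¹' {d : Noise | x < d (Sum.inl 0)}) =
      expMeasure lam (Set.Ioi x) := by
    rw [← Measure.map_apply (measurable_shiftNoise_const i 0) hgap, map_shiftNoise_zero]
    have h := map_eval_noiseLaw (lam := lam) (μ := μ) (Sum.inl 0)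
    change _ = expMeasure lam at h
    rw [← h, Measure.map_apply (measurable_pi_apply _) measurableSet_Ioi]
    rfl
  rw [hhead, hlaw] at hind
  calc expMeasure lam (Set.Ioi x) * 2⁻¹ ≤ expMeasure lam (Set.Ioi x) * noiseLaw lam μ Badᶜ := by
        gcongr
    _ = _ := (mul_comm _ _).trans hind.symm
    _ ≤ _ := by
        refine measure_mono ?_
        rintro d ⟨h1, h2⟩ j hj
        have h3 : x < d (Sum.inl i) := by
          have h2' : x < shiftNoise i 0 d (Sum.inl 0) := h2
          simpa [shiftNoise] using h2'
        have h4 : c * d (Sum.inr j) ≤ x + ∑ l ∈ Finset.Ico (j + 1) i, d (Sum.inl l) := by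
          by_contra hlt
          refine h1 ?_
          rw [hBad]
          exact Set.mem_biUnion (Finset.mem_coe.2 (Finset.mem_range.2 hj)) (not_le.1 hlt)
        rw [arrivals_eq_add_sum hj, reqs]
        linarith

/-- The noises for which infinitely many customers find all the earlier ones gone. -/
def recurrentSet (c : ℝ) : Set Noise := {d | ∃ᶠ i in atTop, IsRegen c d i}

theorem recurrentSet_eq (c : ℝ) :
    recurrentSet c = ⋂ m : ℕ, ⋃ i : ℕ, ⋃ _ : m ≤ i, {d | IsRegen c d i} := by
  ext d
  simp [recurrentSet, frequently_atTop]

theorem measurableSet_recurrentSet (c : ℝ) : MeasurableSet (recurrentSet c) := by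
  rw [recurrentSet_eq]
  exact MeasurableSet.iInter fun m => MeasurableSet.iUnion fun i => MeasurableSet.iUnion fun _ =>
    measurableSet_isRegen c i

/-- Recurrence is a tail property: the arrival epochs diverge, so finitely many extra customers
eventually obstruct no regeneration. -/
theorem Good.shiftNoise_mem_recurrentSet_iff {d : Noise} (hd : Good d) (c : ℝ) (k : ℕ) :
    shiftNoise k 0 d ∈ recurrentSet c ↔ d ∈ recurrentSet c := by
  have hA : ∀ i, arrivals (shiftNoise k 0 d) i =
      arrivals d (k + i) - ∑ i ∈ Finset.range k, d (Sum.inl i) := fun i => by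
    rw [arrivals_shiftNoise, zero_add]
  have hR : ∀ i, reqs (shiftNoise k 0 d) i = reqs d (k + i) := fun i => rfl
  simp only [recurrentSet, Set.mem_ofPred_eq]
  constructor
  · intro h
    have hev : ∀ᶠ i in atTop, ∀ j ∈ Finset.range k, arrivals d j + c * reqs d j ≤ arrivals d (k + i) := by
      rw [Filter.eventually_all_finset]
      intro j _
      have : Tendsto (fun i => arrivals d (k + i)) atTop atTop :=
        hd.2.comp (tendsto_atTop_mono (fun a => Nat.le_add_left a k) tendsto_id)
      exact this.eventually_ge_atTop _
    have h2 : ∃ᶠ i in atTop, IsRegen c d (k + i) := by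
      refine (h.and_eventually hev).mono ?_
      rintro i ⟨h1, h2⟩ j hj
      rcases lt_or_ge j k with hjk | hjk
      · exact h2 j (Finset.mem_range.2 hjk)
      · obtain ⟨l, rfl⟩ := Nat.exists_eq_add_of_le hjk
        have := h1 l (by omega)
        rw [hA, hA, hR] at this
        linarith
    rw [frequently_atTop] at h2 ⊢
    intro a
    obtain ⟨b, hb, hb'⟩ := h2 a
    exact ⟨k + b, by omega, hb'⟩
  · intro h
    rw [frequently_atTop] at h ⊢
    intro a
    obtain ⟨b, hb, hb'⟩ := h (k + a)
    obtain ⟨i, rfl⟩ := Nat.exists_eq_add_of_le (show k ≤ b by omega)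
    refine ⟨i, by omega, fun j hj => ?_⟩
    have := hb' (k + j) (by omega)
    rw [hA, hA, hR]
    linarith

/-- Kolmogorov's argument: the event almost surely depends only on the tail, so it is independent of
every head, hence of the σ-algebra generated by all heads, and thus of itself. -/
theorem noiseLaw_recurrentSet_eq_zero_or_one (c : ℝ) :
    noiseLaw lam μ (recurrentSet c) = 0 ∨ noiseLaw lam μ (recurrentSet c) = 1 := by
  set L := recurrentSet c with hL
  have hLm : MeasurableSet L := measurableSet_recurrentSet c
  have hpm : Measurable fun d : Noise => d ∈ L := measurableSet_setOfPred.1 hLm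
  have hk : ∀ k, IndepFun (headNoise k) (fun d => d ∈ L) (noiseLaw lam μ) := by
    intro k
    have h := (indepFun_headNoise_shiftNoise (lam := lam) (μ := μ) k).comp measurable_id hpm
    refine h.congr (EventuallyEq.refl _ _) ?_
    filter_upwards [ae_good_noiseLaw (lam := lam) (μ := μ)] with d hd
    exact propext (hd.shiftNoise_mem_recurrentSet_iff c k)
  have hmono : Monotone fun k => MeasurableSpace.comap (headNoise k) inferInstance := by
    intro k l hkl
    have e : headNoise k = headNoise k ∘ headNoise l := by
      funext d i
      rcases i with i | i
      all_goals
        simp only [headNoise, Function.comp, Sum.elim_inl, Sum.elim_inr]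
        split_ifs with h1 h2
        · rfl
        · omega
        · rfl
    change MeasurableSpace.comap (headNoise k) _ ≤ MeasurableSpace.comap (headNoise l) _
    rw [e, ← MeasurableSpace.comap_comp]
    exact MeasurableSpace.comap_mono (measurable_headNoise k).comap_le
  have hind := indep_iSup_of_monotone (m1 := MeasurableSpace.comap (fun d => d ∈ L) inferInstance)
    hk (fun k => (measurable_headNoise k).comap_le) hpm.comap_le hmono
  have hle : (inferInstance : MeasurableSpace Noise) ≤
      ⨆ k, MeasurableSpace.comap (headNoise k) inferInstance := by
    refine iSup_le fun i => ?_
    set k := Sum.elim id id i + 1 with hk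
    refine le_iSup_of_le k ?_
    have e : (fun d : Noise => d i) = (fun d => d i) ∘ headNoise k := by
      funext d
      rcases i with i | i <;> simp [headNoise, hk]
    rw [e, ← MeasurableSpace.comap_comp]
    exact MeasurableSpace.comap_mono (measurable_pi_apply i).comap_le
  refine measure_eq_zero_or_one_of_indepSet_self ?_
  refine (indep_of_indep_of_le_left hind hle).indepSet_of_measurableSet hLm ?_
  exact ⟨{True}, trivial, by ext d; simp⟩

/-- An upper limit of events of probability at least `p` has probability at least `p`, and the
zero-one law does the rest. -/
theorem ae_mem_recurrentSet {c : ℝ} (hc : 0 < c) : ∀ᵐ d ∂(noiseLaw lam μ), d ∈ recurrentSet c := by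
  obtain ⟨p, hp, hle⟩ := exists_le_noiseLaw_isRegen (lam := lam) (μ := μ) hc
  have h : p ≤ noiseLaw lam μ (recurrentSet c) := by
    rw [recurrentSet_eq, Antitone.measure_iInter]
    · refine le_iInf fun m => (hle m).trans (measure_mono ?_)
      exact Set.subset_iUnion₂_of_subset m le_rfl subset_rfl
    · intro m m' hmm
      exact Set.iUnion_mono fun i => Set.iUnion_mono' fun hi => ⟨hmm.trans hi, subset_rfl⟩
    · exact fun m => (MeasurableSet.iUnion fun i => MeasurableSet.iUnion fun _ =>
        measurableSet_isRegen c i).nullMeasurableSet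
    · exact ⟨0, measure_ne_top _ _⟩
  rcases noiseLaw_recurrentSet_eq_zero_or_one (lam := lam) (μ := μ) c with h0 | h1
  · rw [h0] at h
    exact absurd hp (not_lt.2 h)
  · exact (mem_ae_iff_prob_eq_one (measurableSet_recurrentSet c)).2 h1

end Recurrence

/-! ### Uniform estimates for the regeneration times -/

section Tightness

variable {lam μ : ℝ} [hlam : Fact (0 < lam)] [hμ : Fact (0 < μ)]

/-- A union bound over all customers: arrival by time `1` allows `y` to be replaced by `y - 1 +
arrivals d j`, and the Chernoff bound then decays geometrically in `j`. -/
theorem noiseLaw_exists_arrivals_le_one {c : ℝ} (hc : 0 < c) (y : ℝ) :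
    noiseLaw lam μ {d | ∃ j, arrivals d j ≤ 1 ∧ y < c * reqs d j} ≤
      ENNReal.ofReal (2 * Real.exp (-(μ / (2 * c) * (y - 1)))) *
        (1 - ENNReal.ofReal (lam / (lam + μ / (2 * c))))⁻¹ := by
  set r := ENNReal.ofReal (lam / (lam + μ / (2 * c))) with hr
  have hr1 : r ≤ 1 := (ratio_lt_one hc).le
  calc noiseLaw lam μ {d | ∃ j, arrivals d j ≤ 1 ∧ y < c * reqs d j}
      ≤ noiseLaw lam μ (⋃ j : ℕ, {d | y - 1 + ∑ l ∈ Finset.range (j + 1), d (Sum.inl l) <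
          c * d (Sum.inr j)}) := by
        refine measure_mono ?_
        rintro d ⟨j, h1, h2⟩
        refine Set.mem_iUnion.2 ⟨j, ?_⟩
        change y - 1 + arrivals d j < c * reqs d j
        linarith
    _ ≤ ∑' j : ℕ, noiseLaw lam μ {d | y - 1 + ∑ l ∈ Finset.range (j + 1), d (Sum.inl l) <
          c * d (Sum.inr j)} := measure_iUnion_le _
    _ ≤ ∑' j : ℕ, ENNReal.ofReal (2 * Real.exp (-(μ / (2 * c) * (y - 1)))) * r ^ j := by
        refine ENNReal.tsum_le_tsum fun j => ?_
        have h := noiseLaw_sum_lt_le (lam := lam) (μ := μ) hc (y - 1) (Finset.range (j + 1)) j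
        rw [Finset.card_range] at h
        refine h.trans ?_
        exact mul_le_mul_right (pow_le_pow_of_le_one zero_le hr1 (Nat.le_succ j)) _
    _ = _ := by rw [ENNReal.tsum_mul_left, ENNReal.tsum_geometric]

/-- Customers are sorted by the unit interval of their arrival. Those of the last interval are seen
through the noise restarted at its beginning, which has the same law; for the earlier ones the level
rises to `x + 1`. -/
theorem noiseLaw_residual_le_sum {c : ℝ} (K : ℕ) (x : ℝ) :
    noiseLaw lam μ {d | ∃ j, arrivals d j ≤ K ∧ K + x < arrivals d j + c * reqs d j} ≤
      ∑ i ∈ Finset.range K,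
        noiseLaw lam μ {d | ∃ j, arrivals d j ≤ 1 ∧ x + i < c * reqs d j} := by
  induction K generalizing x with
  | zero =>
    rw [Finset.sum_range_zero, le_zero_iff, measure_eq_zero_iff_ae_notMem]
    filter_upwards [ae_good_noiseLaw (lam := lam) (μ := μ)] with d hd
    rintro ⟨j, h1, _⟩
    have h2 : arrivals d 0 = d (Sum.inl 0) := by simp [arrivals]
    have h3 := hd.strictMono.monotone (Nat.zero_le j)
    have h4 := hd.1 (Sum.inl 0)
    rw [Nat.cast_zero] at h1
    linarith
  | succ K ih =>
    have hW : MeasurableSet {d : Noise | ∃ j, arrivals d j ≤ 1 ∧ x < c * reqs d j} := by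
      refine measurableSet_setOfPred.2 (.exists fun j => ?_)
      exact (measurableSet_setOfPred.1 (measurableSet_le (measurable_arrivals j) measurable_const)).and
        (measurableSet_setOfPred.1 (measurableSet_lt measurable_const
          ((measurable_reqs j).const_mul c)))
    have hK : (0 : ℝ) ≤ K := K.cast_nonneg
    calc noiseLaw lam μ {d | ∃ j, arrivals d j ≤ (K + 1 : ℕ) ∧
          (K + 1 : ℕ) + x < arrivals d j + c * reqs d j}
        ≤ noiseLaw lam μ ({d | ∃ j, arrivals d j ≤ K ∧ K + (x + 1) < arrivals d j + c * reqs d j} ∪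
            restartNoise K ⁻¹' {d | ∃ j, arrivals d j ≤ 1 ∧ x < c * reqs d j}) := by
          refine measure_mono_ae ?_
          filter_upwards [ae_good_noiseLaw (lam := lam) (μ := μ)] with d hd
          rintro ⟨j, h1, h2⟩
          push_cast at h1 h2
          rcases le_or_gt (arrivals d j) K with hj | hj
          · exact Or.inl ⟨j, hj, by linarith⟩
          · have hge : countBefore K d ≤ j :=
              not_lt.1 fun h => absurd ((hd.lt_countBefore_iff K j).1 h) (not_le.2 hj)
            obtain ⟨i, rfl⟩ := Nat.exists_eq_add_of_le hge
            refine Or.inr ⟨i, ?_, ?_⟩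
            · rw [arrivals_restartNoise]
              linarith
            · rw [reqs_restartNoise]
              linarith
      _ ≤ noiseLaw lam μ {d | ∃ j, arrivals d j ≤ K ∧ K + (x + 1) < arrivals d j + c * reqs d j} +
          noiseLaw lam μ (restartNoise K ⁻¹' {d | ∃ j, arrivals d j ≤ 1 ∧ x < c * reqs d j}) :=
          measure_union_le _ _
      _ ≤ ∑ i ∈ Finset.range K,
            noiseLaw lam μ {d | ∃ j, arrivals d j ≤ 1 ∧ x + 1 + i < c * reqs d j} +
          noiseLaw lam μ {d | ∃ j, arrivals d j ≤ 1 ∧ x < c * reqs d j} := by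
          rw [(measurePreserving_restartNoise hK).measure_preimage hW.nullMeasurableSet]
          gcongr
          exact ih (x + 1)
      _ = _ := by
          rw [Finset.sum_range_succ', Nat.cast_zero, add_zero]
          congr 1
          refine Finset.sum_congr rfl fun i _ => ?_
          push_cast
          simp only [add_assoc, add_comm (1 : ℝ)]

/-- The residual sojourn times of the customers present at an integer time are tight. -/
theorem exists_noiseLaw_residual_le {c : ℝ} (hc : 0 < c) {δ : ENNReal} (hδ : 0 < δ) :
    ∃ x : ℝ, 0 ≤ x ∧ ∀ K : ℕ, noiseLaw lam μ
      {d | ∃ j, arrivals d j ≤ K ∧ K + x < arrivals d j + c * reqs d j} ≤ δ := by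
  have hμ' := hμ.out
  have hβ : 0 < μ / (2 * c) := by positivity
  set C := (1 - ENNReal.ofReal (lam / (lam + μ / (2 * c))))⁻¹ with hC
  have hCtop : C ≠ ⊤ := ENNReal.inv_ne_top.2 (tsub_pos_of_lt (ratio_lt_one hc)).ne'
  -- Each unit of time since the arrival costs a factor `q`, so the bound is summable uniformly in
  -- `K`.
  set q := ENNReal.ofReal (Real.exp (-(μ / (2 * c)))) with hq
  have hq1 : q < 1 := by
    rw [hq, ENNReal.ofReal_lt_one, Real.exp_lt_one_iff]
    linarith
  have hqtop : (1 - q)⁻¹ ≠ ⊤ := ENNReal.inv_ne_top.2 (tsub_pos_of_lt hq1).ne'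
  have hbound : ∀ (x : ℝ) (K : ℕ), noiseLaw lam μ
      {d | ∃ j, arrivals d j ≤ K ∧ K + x < arrivals d j + c * reqs d j} ≤
      ENNReal.ofReal (2 * Real.exp (-(μ / (2 * c) * (x - 1)))) * (C * (1 - q)⁻¹) := by
    intro x K
    calc _ ≤ _ := noiseLaw_residual_le_sum K x
      _ ≤ ∑ i ∈ Finset.range K,
          ENNReal.ofReal (2 * Real.exp (-(μ / (2 * c) * (x - 1)))) * C * q ^ i := by
          refine Finset.sum_le_sum fun i _ => (noiseLaw_exists_arrivals_le_one hc _).trans ?_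
          rw [mul_right_comm, hq, ← ENNReal.ofReal_pow (Real.exp_pos _).le, ← Real.exp_nat_mul,
            ← ENNReal.ofReal_mul (by positivity), mul_assoc, ← Real.exp_add]
          gcongr
          apply le_of_eq
          ring
      _ = ENNReal.ofReal (2 * Real.exp (-(μ / (2 * c) * (x - 1)))) * C *
          ∑ i ∈ Finset.range K, q ^ i := by rw [Finset.mul_sum]
      _ ≤ _ := by
          rw [mul_assoc, ← ENNReal.tsum_geometric]
          gcongr
          exact ENNReal.sum_le_tsum _
  have h0 : Tendsto (fun x : ℝ => μ / (2 * c) * (x - 1)) atTop atTop :=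
    (tendsto_atTop_add_const_right _ (-1) tendsto_id).const_mul_atTop hβ
  have h1 : Tendsto (fun x : ℝ => 2 * Real.exp (-(μ / (2 * c) * (x - 1)))) atTop (nhds (2 * 0)) :=
    (Real.tendsto_exp_neg_atTop_nhds_zero.comp h0).const_mul 2
  have h2 := ENNReal.Tendsto.mul_const (b := C * (1 - q)⁻¹) (ENNReal.tendsto_ofReal h1)
    (Or.inr (ENNReal.mul_ne_top hCtop hqtop))
  rw [mul_zero, ENNReal.ofReal_zero, zero_mul] at h2
  obtain ⟨x, hx1, hx2⟩ := ((h2.eventually (ge_mem_nhds hδ)).and (eventually_ge_atTop 0)).exists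
  exact ⟨x, hx2, fun K => (hbound x K).trans hx1⟩

/-- No regeneration takes place between `s` and `s + t`. -/
def noRegenSet (c s t : ℝ) : Set Noise :=
  {d | ¬ ∃ p, IsRegen c d (countBefore s d + p) ∧ arrivals (restartNoise s d) p ≤ t}

theorem measurableSet_noRegenSet (c s t : ℝ) : MeasurableSet (noRegenSet c s t) := by
  refine MeasurableSet.compl (measurableSet_setOfPred.2 (.exists fun p => .and ?_ ?_))
  · refine measurable_apply_nat (g := fun k d => IsRegen c d (k + p)) (fun k => ?_)
      (measurable_countBefore s)
    exact measurableSet_setOfPred.1 (measurableSet_isRegen c (k + p))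
  · exact measurableSet_setOfPred.1 (measurableSet_le
      ((measurable_arrivals p).comp (measurable_restartNoise s)) measurable_const)

theorem tendsto_noiseLaw_noRegenSet {c : ℝ} (hc : 0 < c) (s : ℝ) :
    Tendsto (fun k : ℕ => noiseLaw lam μ (noRegenSet c s k)) atTop (nhds 0) := by
  have h := tendsto_measure_iInter_atTop (μ := noiseLaw lam μ)
    (s := fun k : ℕ => noRegenSet c s k)
    (fun k => (measurableSet_noRegenSet c s k).nullMeasurableSet) ?_ ⟨0, measure_ne_top _ _⟩
  · refine h.congr' .rfl |>.mono_right (le_of_eq (congrArg nhds ?_))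
    rw [measure_eq_zero_iff_ae_notMem]
    filter_upwards [ae_mem_recurrentSet (lam := lam) (μ := μ) hc] with d hd hmem
    rw [Set.mem_iInter] at hmem
    obtain ⟨i, hi, hreg⟩ := (frequently_atTop.1 hd) (countBefore s d)
    obtain ⟨p, rfl⟩ := Nat.exists_eq_add_of_le hi
    obtain ⟨k, hk⟩ := exists_nat_ge (arrivals (restartNoise s d) p)
    exact hmem k ⟨p, hreg, hk⟩
  · intro k l hkl d hd
    rintro ⟨p, h1, h2⟩
    exact hd ⟨p, h1, h2.trans (Nat.cast_le.2 hkl)⟩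

/-- Up to probability `δ / 2`, all customers arriving by `K` are gone from the dominating queue by
`K + x`. A regeneration of the restarted noise at or after `x` is then one of the original noise,
and the law of the restarted noise does not depend on `K`. -/
theorem tendsto_iSup_noiseLaw_noRegenSet {c : ℝ} (hc : 0 < c) :
    Tendsto (fun k : ℕ => ⨆ K : ℕ, noiseLaw lam μ (noRegenSet c K k)) atTop (nhds 0) := by
  rw [ENNReal.tendsto_nhds_zero]
  intro δ hδ
  have hδ2 : 0 < δ / 2 := ENNReal.half_pos hδ.ne'
  obtain ⟨x, hx0, hx⟩ := exists_noiseLaw_residual_le (lam := lam) (μ := μ) hc hδ2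
  set Q : ℕ → Set Noise := fun k => {d | ¬ ∃ p, IsRegen c d p ∧ x ≤ arrivals d p ∧ arrivals d p ≤ k}
    with hQ
  have hQm : ∀ k, MeasurableSet (Q k) := by
    intro k
    refine MeasurableSet.compl (measurableSet_setOfPred.2 (.exists fun p => .and ?_ (.and ?_ ?_)))
    · exact measurableSet_setOfPred.1 (measurableSet_isRegen c p)
    · exact measurableSet_setOfPred.1 (measurableSet_le measurable_const (measurable_arrivals p))
    · exact measurableSet_setOfPred.1 (measurableSet_le (measurable_arrivals p) measurable_const)
  have hQt : Tendsto (fun k => noiseLaw lam μ (Q k)) atTop (nhds 0) := by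
    have h := tendsto_measure_iInter_atTop (μ := noiseLaw lam μ) (s := Q)
      (fun k => (hQm k).nullMeasurableSet) ?_ ⟨0, measure_ne_top _ _⟩
    · refine h.congr' .rfl |>.mono_right (le_of_eq (congrArg nhds ?_))
      rw [measure_eq_zero_iff_ae_notMem]
      filter_upwards [ae_mem_recurrentSet (lam := lam) (μ := μ) hc, ae_good_noiseLaw] with d hd hg hmem
      rw [Set.mem_iInter] at hmem
      obtain ⟨i, hreg, hi⟩ := (Frequently.and_eventually (show ∃ᶠ i in atTop, IsRegen c d i from hd)
        (hg.2.eventually_ge_atTop x)).exists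
      obtain ⟨k, hk⟩ := exists_nat_ge (arrivals d i)
      exact hmem k ⟨i, hreg, hi, hk⟩
    · intro k l hkl d hd
      rintro ⟨p, h1, h2, h3⟩
      exact hd ⟨p, h1, h2, h3.trans (Nat.cast_le.2 hkl)⟩
  filter_upwards [hQt.eventually (ge_mem_nhds hδ2)] with k hk
  refine iSup_le fun K => ?_
  have hK : (0 : ℝ) ≤ K := K.cast_nonneg
  calc noiseLaw lam μ (noRegenSet c K k)
      ≤ noiseLaw lam μ ({d | ∃ j, arrivals d j ≤ K ∧ K + x < arrivals d j + c * reqs d j} ∪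
          restartNoise K ⁻¹' Q k) := by
        refine measure_mono_ae ?_
        filter_upwards [ae_good_noiseLaw (lam := lam) (μ := μ)] with d hd hno
        by_contra hnot
        have h1 : ¬ ∃ j, arrivals d j ≤ K ∧ K + x < arrivals d j + c * reqs d j :=
          fun h => hnot (Or.inl h)
        have h2 : restartNoise K d ∉ Q k := fun h => hnot (Or.inr h)
        have h2' : ∃ p, IsRegen c (restartNoise K d) p ∧ x ≤ arrivals (restartNoise K d) p ∧
            arrivals (restartNoise K d) p ≤ k := by
          by_contra h
          exact h2 h
        obtain ⟨p, hp1, hp2, hp3⟩ := h2'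
        refine hno ⟨p, fun j hj => ?_, hp3⟩
        rw [arrivals_restartNoise] at hp2
        rcases lt_or_ge j (countBefore K d) with hjK | hjK
        · by_contra hlt
          refine h1 ⟨j, (hd.lt_countBefore_iff K j).1 hjK, ?_⟩
          linarith [not_le.1 hlt]
        · obtain ⟨i, rfl⟩ := Nat.exists_eq_add_of_le hjK
          have := hp1 i (by omega)
          rw [arrivals_restartNoise, arrivals_restartNoise, reqs_restartNoise] at this
          linarith
    _ ≤ _ := measure_union_le _ _
    _ ≤ δ / 2 + δ / 2 := by
        rw [(measurePreserving_restartNoise hK).measure_preimage (hQm k).nullMeasurableSet]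
        exact add_le_add (hx K) hk
    _ = δ := ENNReal.add_halves δ

end Tightness

/-! ### Setwise limits of probability measures -/

section SetwiseLimit

/-- Uniformity over all measurable sets lets the limit be exchanged with countable unions, which
gives σ-additivity without any topology or tightness on `α`. -/
theorem exists_measure_tendsto_of_uniform_cauchy {α : Type*} [MeasurableSpace α]
    (κ : ℕ → Measure α) [∀ k, IsProbabilityMeasure (κ k)] {ε : ℕ → ℝ}
    (hε : Tendsto ε atTop (nhds 0))
    (h : ∀ k K A, MeasurableSet A → |(κ (k + K)).real A - (κ k).real A| ≤ ε k) :
    ∃ m : Measure α, IsProbabilityMeasure m ∧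
      ∀ A, MeasurableSet A → Tendsto (fun k => (κ k).real A) atTop (nhds (m.real A)) := by
  have hlim : ∀ A, ∃ l, MeasurableSet A → Tendsto (fun k => (κ k).real A) atTop (nhds l) := by
    intro A
    by_cases hA : MeasurableSet A
    · have : CauchySeq fun k => (κ k).real A := by
        refine Metric.cauchySeq_iff'.2 fun δ hδ => ?_
        obtain ⟨N, hN⟩ := (hε.eventually (gt_mem_nhds hδ)).exists
        refine ⟨N, fun k hk => ?_⟩
        obtain ⟨K, rfl⟩ := Nat.exists_eq_add_of_le hk
        rw [Real.dist_eq]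
        exact (h N K A hA).trans_lt hN
      obtain ⟨l, hl⟩ := cauchySeq_tendsto_of_complete this
      exact ⟨l, fun _ => hl⟩
    · exact ⟨0, fun h => absurd h hA⟩
  choose L hL using hlim
  have hL0 : ∀ A, MeasurableSet A → 0 ≤ L A := fun A hA =>
    ge_of_tendsto' (hL A hA) fun k => measureReal_nonneg
  have hunif : ∀ k A, MeasurableSet A → |L A - (κ k).real A| ≤ ε k := by
    intro k A hA
    have h1 : Tendsto (fun K => |(κ (k + K)).real A - (κ k).real A|) atTop
        (nhds |L A - (κ k).real A|) :=
      (((hL A hA).comp (tendsto_atTop_mono (fun a => Nat.le_add_left a k) tendsto_id)).sub_const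
        _).abs
    exact le_of_tendsto' h1 fun K => h k K A hA
  have hempty : L ∅ = 0 := tendsto_nhds_unique (hL ∅ MeasurableSet.empty) (by simp)
  have hsum : ∀ f : ℕ → Set α, (∀ i, MeasurableSet (f i)) → Pairwise (Function.onFun Disjoint f) →
      HasSum (fun i => L (f i)) (L (⋃ i, f i)) := by
    intro f hf hdisj
    rw [hasSum_iff_tendsto_nat_of_nonneg fun i => hL0 _ (hf i)]
    set U : ℕ → Set α := fun N => ⋃ i ∈ Finset.range N, f i with hU
    have hUm : ∀ N, MeasurableSet (U N) := fun N =>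
      Finset.measurableSet_biUnion _ fun i _ => hf i
    have hUsum : ∀ k N, (κ k).real (U N) = ∑ i ∈ Finset.range N, (κ k).real (f i) := fun k N =>
      measureReal_biUnion_finset (fun i _ j _ hij => hdisj hij) fun i _ => hf i
    have hLsum : ∀ N, ∑ i ∈ Finset.range N, L (f i) = L (U N) := by
      intro N
      refine tendsto_nhds_unique (tendsto_finsetSum _ fun i _ => hL _ (hf i)) ?_
      simp only [← hUsum]
      exact hL _ (hUm N)
    simp only [hLsum]
    have hV : ∀ k, Tendsto (fun N => (κ k).real (U N)) atTop (nhds ((κ k).real (⋃ i, f i))) := by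
      intro k
      have hmono : Monotone U := fun a b hab =>
        Set.biUnion_subset_biUnion_left (Finset.coe_subset.2 (Finset.range_mono hab))
      have hUf : ⋃ N, U N = ⋃ i, f i := by
        ext a
        simp only [hU, Set.mem_iUnion, Finset.mem_range]
        exact ⟨fun ⟨_, i, _, hi⟩ => ⟨i, hi⟩, fun ⟨i, hi⟩ => ⟨i + 1, i, i.lt_succ_self, hi⟩⟩
      rw [← hUf]
      exact (ENNReal.tendsto_toReal (measure_ne_top _ _)).comp (tendsto_measure_iUnion_atTop hmono)
    rw [Metric.tendsto_atTop]
    intro δ hδ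
    obtain ⟨k, hk⟩ := (hε.eventually (gt_mem_nhds (by positivity : (0 : ℝ) < δ / 3))).exists
    obtain ⟨N, hN⟩ := (Metric.tendsto_atTop.1 (hV k)) (δ / 3) (by positivity)
    refine ⟨N, fun M hM => ?_⟩
    have h1 := hN M hM
    have h2 := hunif k _ (hUm M)
    have h3 := hunif k _ (MeasurableSet.iUnion hf)
    rw [Real.dist_eq] at h1 ⊢
    rw [abs_lt] at h1 ⊢
    rw [abs_le] at h2 h3
    constructor <;> linarith [h1.1, h1.2, h2.1, h2.2, h3.1, h3.2]
  set m : Measure α := Measure.ofMeasurable (fun A _ => ENNReal.ofReal (L A)) (by simp [hempty])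
    (fun f hf hdisj => by
      rw [← (hsum f hf hdisj).tsum_eq,
        ENNReal.ofReal_tsum_of_nonneg (fun i => hL0 _ (hf i)) (hsum f hf hdisj).summable]) with hm
  have hmA : ∀ A, MeasurableSet A → m A = ENNReal.ofReal (L A) := fun A hA =>
    Measure.ofMeasurable_apply A hA
  refine ⟨m, ⟨?_⟩, fun A hA => ?_⟩
  · rw [hmA _ MeasurableSet.univ, tendsto_nhds_unique (hL _ MeasurableSet.univ)
      (by simp : Tendsto (fun k => (κ k).real Set.univ) atTop (nhds 1)), ENNReal.ofReal_one]
  · rw [measureReal_def, hmA A hA, ENNReal.toReal_ofReal (hL0 A hA)]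
    exact hL A hA

/-- The coupling inequality, valid for arbitrary sets and maps since only monotonicity and
subadditivity enter. -/
theorem abs_measureReal_preimage_sub_le {Ω β : Type*} [MeasurableSpace Ω] {P : Measure Ω}
    [IsFiniteMeasure P] {f g : Ω → β} {N : Set Ω} (h : ∀ᵐ ω ∂P, ω ∉ N → f ω = g ω) (A : Set β) :
    |P.real (f ⁻¹' A) - P.real (g ⁻¹' A)| ≤ P.real N := by
  have key : ∀ f g : Ω → β, (∀ᵐ ω ∂P, ω ∉ N → f ω = g ω) →
      P.real (f ⁻¹' A) ≤ P.real (g ⁻¹' A) + P.real N := by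
    intro f g h
    refine le_trans ?_ (measureReal_union_le _ _)
    refine ENNReal.toReal_mono (measure_ne_top _ _) (measure_mono_ae ?_)
    filter_upwards [h] with ω hω hf
    by_cases hN : ω ∈ N
    · exact Or.inr hN
    · left
      have hf' : f ω ∈ A := hf
      rw [hω hN] at hf'
      exact hf'
  rw [abs_le]
  have h1 := key f g h
  have h2 := key g f (h.mono fun ω hω hN => (hω hN).symm)
  constructor <;> linarith

end SetwiseLimit

/-! ### The stationary system -/

/-- The state at time `s` of the initially empty system, with the noise seen from then on. -/
noncomputable def restartPair (n : ℕ) (μ θ s : ℝ) (d : Noise) : InitState × Noise :=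
  (state n μ θ s d, restartNoise s d)

theorem measurable_restartPair {n : ℕ} {μ θ : ℝ} (hn : 1 ≤ n) (s : ℝ) : Measurable (restartPair n μ θ s) :=
  (measurable_state hn s).prodMk (measurable_restartNoise s)

theorem ext_of_measureReal {α : Type*} [MeasurableSpace α] {P Q : Measure α} [IsFiniteMeasure P]
    [IsFiniteMeasure Q] (h : ∀ A, MeasurableSet A → P.real A = Q.real A) : P = Q := by
  ext A hA
  exact (ENNReal.toReal_eq_toReal_iff' (measure_ne_top _ _) (measure_ne_top _ _)).1 (h A hA)

section Stationary

variable {n : ℕ} {lam μ θ : ℝ} [hlam : Fact (0 < lam)] [hμ : Fact (0 < μ)]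

theorem noiseLaw_restartPair_prod (hn : 1 ≤ n) {s : ℝ} (hs : 0 ≤ s) {A : Set InitState}
    (hA : MeasurableSet A) {B : Set Noise} (hB : MeasurableSet B) :
    (noiseLaw lam μ).real (restartPair n μ θ s ⁻¹' (A ×ˢ B)) =
      (noiseLaw lam μ).real (restartPair n μ θ s ⁻¹' (A ×ˢ Set.univ)) *
        (noiseLaw lam μ).real B := by
  have h := noiseLaw_restart (lam := lam) (μ := μ) (measurable_stateAt (μ := μ) (θ := θ) hn s)
    (stateAt_headNoise n μ θ s) hs hA hB
  have e : restartPair n μ θ s ⁻¹' (A ×ˢ Set.univ) =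
      {d | stateAt n μ θ s (countBefore s d) d ∈ A} := by
    ext d
    simp [restartPair, state]
  rw [e, measureReal_def, measureReal_def, measureReal_def, ← ENNReal.toReal_mul, ← h]
  rfl

/-- The pair at time `k` has the same law when computed from the noise restarted at `K`. In that
form it is coupled with the pair at time `k + K` and differs from it at most on `noRegenSet`, up to
a null set; the bound is uniform in the event and in `K`. -/
theorem exists_limit_restartPair (hn : 1 ≤ n) (hθ : 0 < θ) :
    ∃ κ : Measure (InitState × Noise), IsProbabilityMeasure κ ∧ ∀ A, MeasurableSet A →
      Tendsto (fun k : ℕ => (noiseLaw lam μ).real (restartPair n μ θ k ⁻¹' A)) atTop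
        (nhds (κ.real A)) := by
  have hc : 0 < 1 + μ / θ := by have := hμ.out; positivity
  have hm := fun k : ℕ => measurable_restartPair (μ := μ) (θ := θ) hn k
  have hprob : ∀ k : ℕ, IsProbabilityMeasure ((noiseLaw lam μ).map (restartPair n μ θ k)) :=
    fun k => Measure.isProbabilityMeasure_map (hm k).aemeasurable
  have hreal : ∀ (k : ℕ) A, MeasurableSet A → ((noiseLaw lam μ).map (restartPair n μ θ k)).real A =
      (noiseLaw lam μ).real (restartPair n μ θ k ⁻¹' A) := fun k A hA =>
    map_measureReal_apply (hm k) hA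
  have hsup : ∀ k : ℕ, ⨆ K : ℕ, noiseLaw lam μ (noRegenSet (1 + μ / θ) K k) ≠ ⊤ := fun k =>
    ne_top_of_le_ne_top ENNReal.one_ne_top (iSup_le fun K => prob_le_one)
  obtain ⟨κ, hκ, h⟩ := exists_measure_tendsto_of_uniform_cauchy
    (fun k : ℕ => (noiseLaw lam μ).map (restartPair n μ θ k))
    (ε := fun k : ℕ => (⨆ K : ℕ, noiseLaw lam μ (noRegenSet (1 + μ / θ) K k)).toReal)
    ((ENNReal.tendsto_toReal ENNReal.zero_ne_top).comp
      (tendsto_iSup_noiseLaw_noRegenSet (lam := lam) (μ := μ) hc))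
    (by
      intro k K A hA
      have hK : (0 : ℝ) ≤ K := K.cast_nonneg
      have hk : (0 : ℝ) ≤ k := k.cast_nonneg
      rw [hreal _ A hA, hreal _ A hA]
      have e : (noiseLaw lam μ).real (restartPair n μ θ k ⁻¹' A) =
          (noiseLaw lam μ).real ((fun d => restartPair n μ θ k (restartNoise K d)) ⁻¹' A) := by
        rw [measureReal_def, measureReal_def, ← (measurePreserving_restartNoise hK).measure_preimage
          ((hm k) hA).nullMeasurableSet]
        rfl
      rw [e]
      refine (abs_measureReal_preimage_sub_le (N := noRegenSet (1 + μ / θ) K k) ?_ A).trans ?_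
      · filter_upwards [ae_good_noiseLaw (lam := lam) (μ := μ)] with d hd hno
        obtain ⟨p, hp1, hp2⟩ := not_not.1 hno
        rw [Nat.cast_add]
        exact Prod.ext (hd.state_add hk hp1 hp2) (hd.restart_add hk)
      · exact ENNReal.toReal_mono (hsup k) (le_iSup (fun K : ℕ =>
          noiseLaw lam μ (noRegenSet (1 + μ / θ) K k)) K))
  refine ⟨κ, hκ, fun A hA => ?_⟩
  have := h A hA
  simpa only [hreal _ A hA] using this

variable {κ : Measure (InitState × Noise)}

theorem map_snd_of_tendsto [IsProbabilityMeasure κ] (h : ∀ A, MeasurableSet A →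
      Tendsto (fun k : ℕ => (noiseLaw lam μ).real (restartPair n μ θ k ⁻¹' A)) atTop
        (nhds (κ.real A))) :
    κ.map Prod.snd = noiseLaw lam μ := by
  have := Measure.isProbabilityMeasure_map (μ := κ) measurable_snd.aemeasurable
  refine ext_of_measureReal fun B hB => ?_
  rw [map_measureReal_apply measurable_snd hB]
  refine tendsto_nhds_unique (h _ (measurable_snd hB)) ?_
  have e : ∀ k : ℕ, (noiseLaw lam μ).real (restartPair n μ θ k ⁻¹' (Prod.snd ⁻¹' B)) =
      (noiseLaw lam μ).real B := by
    intro k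
    rw [measureReal_def, measureReal_def, ← (measurePreserving_restartNoise
      (lam := lam) (μ := μ) (Nat.cast_nonneg k)).measure_preimage hB.nullMeasurableSet]
    rfl
  simp only [e]
  exact tendsto_const_nhds

theorem indepFun_fst_snd_of_tendsto [IsProbabilityMeasure κ] (hn : 1 ≤ n) (h : ∀ A, MeasurableSet A →
      Tendsto (fun k : ℕ => (noiseLaw lam μ).real (restartPair n μ θ k ⁻¹' A)) atTop
        (nhds (κ.real A))) :
    IndepFun Prod.fst Prod.snd κ := by
  rw [indepFun_iff_measure_inter_preimage_eq_mul]
  intro A B hA hB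
  have hsnd : κ (Prod.snd ⁻¹' B) = noiseLaw lam μ B := by
    rw [← map_snd_of_tendsto h, Measure.map_apply measurable_snd hB]
  have hreal : κ.real (A ×ˢ B) = κ.real (A ×ˢ Set.univ) * (noiseLaw lam μ).real B := by
    refine tendsto_nhds_unique (h _ (hA.prod hB)) ?_
    simp only [noiseLaw_restartPair_prod hn (Nat.cast_nonneg _) hA hB]
    exact (h _ (hA.prod MeasurableSet.univ)).mul_const _
  rw [hsnd, ← Set.prod_eq, ← Set.prod_univ,
    ← ENNReal.toReal_eq_toReal_iff' (measure_ne_top _ _)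
      (ENNReal.mul_ne_top (measure_ne_top _ _) (measure_ne_top _ _)), ENNReal.toReal_mul]
  exact hreal

/-- Some of the conditions are strict inequalities, which a weak limit could lose; setwise
convergence preserves almost sure events. -/
theorem ae_validState_of_tendsto [IsProbabilityMeasure κ] (hn : 1 ≤ n) (h : ∀ A, MeasurableSet A →
      Tendsto (fun k : ℕ => (noiseLaw lam μ).real (restartPair n μ θ k ⁻¹' A)) atTop
        (nhds (κ.real A))) :
    ∀ᵐ x ∂κ, ValidState n μ θ x.1 := by
  have hm : MeasurableSet {x : InitState × Noise | ValidState n μ θ x.1}ᶜ :=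
    (measurable_fst measurableSet_validState).compl
  rw [ae_iff, ← measureReal_eq_zero_iff]
  refine tendsto_nhds_unique (h _ hm) ?_
  have e : ∀ k : ℕ, (noiseLaw lam μ).real (restartPair n μ θ k ⁻¹'
      {x : InitState × Noise | ValidState n μ θ x.1}ᶜ) = 0 := by
    intro k
    rw [measureReal_eq_zero_iff, measure_eq_zero_iff_ae_notMem]
    filter_upwards [ae_good_noiseLaw (lam := lam) (μ := μ)] with d hd hmem
    exact hmem (hd.validState hn k)
  exact (tendsto_congr e).2 tendsto_const_nhds

/-- Before the limit, the shifted path is the empty-start path from time `k + r` on, and the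
unshifted one has the law of the path from time `k` on of the system restarted empty at `r`. The two
coincide once a regeneration has occurred between `r` and `r + k`. -/
theorem measureReal_pathFrom_shift (hn : 1 ≤ n) (hθ : 0 < θ) (h : ∀ A, MeasurableSet A →
      Tendsto (fun k : ℕ => (noiseLaw lam μ).real (restartPair n μ θ k ⁻¹' A)) atTop
        (nhds (κ.real A))) (r : ℝ≥0) {B : Set (ℝ≥0 → ℕ)} (hB : MeasurableSet B) :
    κ.real ((fun x t => pathFrom n μ θ x (r + t)) ⁻¹' B) =
      κ.real ((fun x t => pathFrom n μ θ x t) ⁻¹' B) := by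
  have hμ' := hμ.out
  have hc : 0 < 1 + μ / θ := by positivity
  have hF : Measurable fun x => pathFrom n μ θ x := measurable_pathFrom hn
  have hFr : Measurable fun x (t : ℝ≥0) => pathFrom n μ θ x (r + t) :=
    measurable_pi_iff.2 fun t => measurable_pi_iff.1 hF (r + t)
  have hE : Measurable fun d => emptyPath n μ θ d := measurable_emptyPath hn
  have h1 := (h _ (hFr hB)).sub (h _ (hF hB))
  have h2 : Tendsto (fun k : ℕ => (noiseLaw lam μ).real (noRegenSet (1 + μ / θ) r k)) atTop
      (nhds 0) :=
    (ENNReal.tendsto_toReal ENNReal.zero_ne_top).comp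
      (tendsto_noiseLaw_noRegenSet (lam := lam) (μ := μ) hc r)
  refine sub_eq_zero.1 (tendsto_nhds_unique h1 (squeeze_zero_norm (fun k => ?_) h2))
  have e : (noiseLaw lam μ).real
      (restartPair n μ θ k ⁻¹' ((fun x t => pathFrom n μ θ x t) ⁻¹' B)) =
      (noiseLaw lam μ).real
        ((fun d (t : ℝ≥0) => emptyPath n μ θ (restartNoise r d) (k + t)) ⁻¹' B) := by
    have e1 : (noiseLaw lam μ).real
        (restartPair n μ θ k ⁻¹' ((fun x t => pathFrom n μ θ x t) ⁻¹' B)) =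
        (noiseLaw lam μ).real ((fun d (t : ℝ≥0) => emptyPath n μ θ d (k + t)) ⁻¹' B) := by
      refine congrArg ENNReal.toReal (measure_congr (eventuallyEq_set.2 ?_))
      filter_upwards [ae_good_noiseLaw (lam := lam) (μ := μ)] with d hd
      have : (fun t : ℝ≥0 => emptyPath n μ θ d (k + t)) =
          fun t => pathFrom n μ θ (restartPair n μ θ k d) t :=
        funext fun t => hd.emptyPath_add hn hμ' hθ k t
      simp only [Set.mem_preimage, this]
    have hm : Measurable fun d (t : ℝ≥0) => emptyPath n μ θ d (k + t) :=
      measurable_pi_iff.2 fun t => measurable_pi_iff.1 hE (k + t)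
    rw [e1, measureReal_def, ← (measurePreserving_restartNoise r.2).measure_preimage
      (hm hB).nullMeasurableSet]
    rfl
  rw [Real.norm_eq_abs, e]
  refine abs_measureReal_preimage_sub_le (f := fun d (t : ℝ≥0) =>
    pathFrom n μ θ (restartPair n μ θ k d) (r + t)) ?_ B
  filter_upwards [ae_good_noiseLaw (lam := lam) (μ := μ)] with d hd hno
  obtain ⟨p, hp1, hp2⟩ := not_not.1 hno
  funext t
  have e1 : pathFrom n μ θ (restartPair n μ θ k d) (r + t) = emptyPath n μ θ d (k + (r + t)) :=
    (hd.emptyPath_add hn hμ' hθ k (r + t)).symm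
  rw [e1, add_left_comm]
  refine hd.emptyPath_restartNoise r hp1 (hp2.trans ?_)
  push_cast
  linarith [t.2, t.coe_nonneg]

/-- The system on a space of initial states and noises. -/
noncomputable def canonicalSystem (κ : Measure (InitState × Noise))
    [IsProbabilityMeasure κ] (hvalid : ∀ᵐ x ∂κ, ValidState n μ θ x.1) (hsnd : κ.map Prod.snd = noiseLaw lam μ)
    (hindep : IndepFun Prod.fst Prod.snd κ) : System κ n lam μ θ where
  K x := x.1.1
  initWait k x := x.1.2.1 k
  initSvc k x := x.1.2.2 k
  gap i x := x.2 (Sum.inl i)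
  svc i x := x.2 (Sum.inr i)
  measurable_K := by fun_prop
  measurable_initWait k := by fun_prop
  measurable_initSvc k := by fun_prop
  measurable_gap i := by fun_prop
  measurable_svc i := by fun_prop
  inService_pos := hvalid.mono fun _ h => h.1
  inQueue_wait_nonneg := hvalid.mono fun _ h => h.2.1
  inQueue_patient := hvalid.mono fun _ h => h.2.2.1
  inQueue_ordered := hvalid.mono fun _ h => h.2.2.2
  gap_law i := by
    refine ⟨by fun_prop, ?_⟩
    have h : κ.map (fun x => x.2 (Sum.inl i)) = (κ.map Prod.snd).map fun d => d (Sum.inl i) :=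
      (Measure.map_map (measurable_pi_apply _) measurable_snd).symm
    rw [h, hsnd, map_eval_noiseLaw]
    rfl
  svc_law i := by
    refine ⟨by fun_prop, ?_⟩
    have h : κ.map (fun x => x.2 (Sum.inr i)) = (κ.map Prod.snd).map fun d => d (Sum.inr i) :=
      (Measure.map_map (measurable_pi_apply _) measurable_snd).symm
    rw [h, hsnd, map_eval_noiseLaw]
    rfl
  indep := by
    have e : (fun (x : InitState × Noise) (i : ℕ ⊕ ℕ) =>
        Sum.elim (fun i (x : InitState × Noise) => x.2 (Sum.inl i))
        (fun i x => x.2 (Sum.inr i)) i x) = Prod.snd := by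
      funext x i
      rcases i with i | i <;> rfl
    have hlaw : ∀ i, HasLaw (Sum.elim (fun i (x : InitState × Noise) => x.2 (Sum.inl i))
        (fun i x => x.2 (Sum.inr i)) i) (coordLaw lam μ i) κ := by
      intro i
      have h : κ.map (fun x => x.2 i) = (κ.map Prod.snd).map fun d => d i :=
        (Measure.map_map (measurable_pi_apply _) measurable_snd).symm
      rw [hsnd, map_eval_noiseLaw] at h
      rcases i with i | i
      · exact ⟨Measurable.aemeasurable (by simp only [Sum.elim_inl]; fun_prop), h⟩
      · exact ⟨Measurable.aemeasurable (by simp only [Sum.elim_inr]; fun_prop), h⟩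
    refine (iIndepFun_iff_hasLaw_Pi_infinitePi hlaw ?_).2 ?_
    · rw [e]
      exact measurable_snd.aemeasurable
    · rw [e]
      exact ⟨measurable_snd.aemeasurable, hsnd⟩
  indep_init := by
    have hψ : Measurable fun d : Noise => ((fun i => d (Sum.inl i)), fun i => d (Sum.inr i)) := by
      fun_prop
    exact hindep.comp measurable_id hψ

theorem exists_isSteadyState (hn : 1 ≤ n) (hθ : 0 < θ) :
    ∃ π : ProbabilityMeasure ℕ, IsSteadyState n lam μ θ π := by
  obtain ⟨κ, hκ, h⟩ := exists_limit_restartPair (n := n) (lam := lam) (μ := μ) hn hθ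
  set M := canonicalSystem κ (ae_validState_of_tendsto hn h) (map_snd_of_tendsto h)
    (indepFun_fst_snd_of_tendsto hn h) with hM
  have hX : ∀ t x, M.X t x = pathFrom n μ θ x t := fun _ _ => rfl
  have hF : Measurable fun x => pathFrom n μ θ x := measurable_pathFrom hn
  have hFt : ∀ t, Measurable fun x => pathFrom n μ θ x t := measurable_pi_iff.1 hF
  have hFr : ∀ r : ℝ≥0, Measurable fun x (t : ℝ≥0) => pathFrom n μ θ x (r + t) := fun r =>
    measurable_pi_iff.2 fun t => hFt (r + t)
  have hid : ∀ s : ℝ≥0, IdentDistrib (fun x (t : ℝ≥0) => M.X (s + t) x)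
      (fun x (t : ℝ≥0) => M.X t x) κ κ := by
    intro s
    simp only [hX]
    refine ⟨(hFr s).aemeasurable, hF.aemeasurable, ?_⟩
    have := Measure.isProbabilityMeasure_map (μ := κ) (hFr s).aemeasurable
    have := Measure.isProbabilityMeasure_map (μ := κ) hF.aemeasurable
    refine ext_of_measureReal fun B hB => ?_
    rw [map_measureReal_apply (hFr s) hB, map_measureReal_apply hF hB]
    exact measureReal_pathFrom_shift hn hθ h s hB
  refine ⟨⟨κ.map (M.X 0), Measure.isProbabilityMeasure_map (hFt 0).aemeasurable⟩,
    InitState × Noise, inferInstance, κ, hκ, M, hid, fun t => ⟨(hFt t).aemeasurable, ?_⟩⟩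
  have h0 := ((hid t).comp (measurable_pi_apply (0 : ℝ≥0))).map_eq
  have e1 : (fun p : ℝ≥0 → ℕ => p 0) ∘ (fun x (u : ℝ≥0) => M.X (t + u) x) = M.X t := by
    funext x
    simp [Function.comp]
  rw [e1] at h0
  exact h0

end Stationary

/-! ### Convergence -/

namespace System

variable {Ω : Type*} [MeasurableSpace Ω] {P : Measure Ω} {n : ℕ} {lam μ θ : ℝ}

/-- The initial state. -/
def initState (M : System P n lam μ θ) (ω : Ω) : InitState :=
  (M.K ω, (fun k => M.initWait k ω), fun k => M.initSvc k ω)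

/-- The driving noise. -/
def noise (M : System P n lam μ θ) (ω : Ω) : Noise := fun i => Sum.elim M.gap M.svc i ω

theorem X_eq_pathFrom (M : System P n lam μ θ) (t : ℝ≥0) (ω : Ω) :
    M.X t ω = pathFrom n μ θ (M.initState ω, M.noise ω) t := rfl

theorem measurable_initState (M : System P n lam μ θ) : Measurable M.initState :=
  M.measurable_K.prodMk ((measurable_pi_iff.2 M.measurable_initWait).prodMk
    (measurable_pi_iff.2 M.measurable_initSvc))

theorem measurable_noise (M : System P n lam μ θ) : Measurable M.noise := by
  refine measurable_pi_iff.2 fun i => ?_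
  rcases i with i | i
  · exact M.measurable_gap i
  · exact M.measurable_svc i

theorem measurable_X (hn : 1 ≤ n) (M : System P n lam μ θ) (t : ℝ≥0) : Measurable (M.X t) := by
  have h : Measurable fun x => pathFrom n μ θ x t := measurable_pi_iff.1 (measurable_pathFrom hn) t
  have e : M.X t = fun ω => pathFrom n μ θ (M.initState ω, M.noise ω) t :=
    funext fun ω => M.X_eq_pathFrom t ω
  rw [e]
  exact h.comp (M.measurable_initState.prodMk M.measurable_noise)

theorem map_noise [Fact (0 < lam)] [Fact (0 < μ)] (M : System P n lam μ θ) :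
    P.map M.noise = noiseLaw lam μ := by
  refine (iIndepFun.hasLaw_infinitePi (μ := coordLaw lam μ) (fun i => ?_) M.indep
    M.measurable_noise.aemeasurable).map_eq
  rcases i with i | i
  · exact M.gap_law i
  · exact M.svc_law i

end System

section Convergence

variable {n : ℕ} {lam μ θ : ℝ}

/-- The initial customers are finitely many, so some regeneration of the noise comes after all of
them have left. -/
theorem Good.eventually_pathFrom_eq {d : Noise} (hd : Good d)
    (hrec : d ∈ recurrentSet (1 + μ / θ)) (e : InitState) :
    ∀ᶠ t : ℝ≥0 in atTop, pathFrom n μ θ (e, d) t = emptyPath n μ θ d t := by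
  set arr := arrivalsFrom n (e, d) with harr
  set svc := reqsFrom (e, d) with hsvc
  have hA : ∀ i, arr (e.1 + i) = arrivals d i := by
    intro i
    simp [harr, arrivalsFrom, arrivals]
  have hS : ∀ i, svc (e.1 + i) = reqs d i := by
    intro i
    simp [hsvc, reqsFrom, reqs]
  have hev : ∀ᶠ i in atTop, ∀ j ∈ Finset.range e.1, departure n μ θ arr svc j ≤ arrivals d i := by
    rw [Filter.eventually_all_finset]
    exact fun j _ => hd.2.eventually_ge_atTop _
  obtain ⟨i, hi, hinit⟩ := (Frequently.and_eventually
    (show ∃ᶠ i in atTop, IsRegen (1 + μ / θ) d i from hrec) hev).exists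
  filter_upwards [eventually_ge_atTop (arrivals d i).toNNReal] with t ht
  have ht' : arrivals d i ≤ t := Real.toNNReal_le_iff_le_coe.1 ht
  refine numberInSystem_eq_of_tail (p := e.1 + i) (p' := i) (s := 0) ?_ ?_ ?_ ?_ ?_ ?_ (by simp)
  · intro j
    rw [add_assoc, ← harr, hA, add_zero]
  · intro j
    rw [add_assoc, ← hsvc, hS]
  · intro j
    rw [add_assoc, ← harr, hA, hA]
    exact hd.strictMono.monotone (Nat.le_add_right _ _)
  · intro j hj
    rw [← harr, ← hsvc, hA]
    rcases lt_or_ge j e.1 with hje | hje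
    · exact hinit j (Finset.mem_range.2 hje)
    · obtain ⟨l, rfl⟩ := Nat.exists_eq_add_of_le hje
      have h1 : departure n μ θ arr svc (e.1 + l) ≤
          arr (e.1 + l) + (1 + μ / θ) * svc (e.1 + l) :=
        departure_le (by rw [hS]; exact (hd.1 _).le)
      rw [hA, hS] at h1
      exact h1.trans (hi l (by omega))
  · exact fun j hj => (hd.dep_le j).trans (hi j hj)
  · rw [← harr, hA]
    exact ht'

open scoped BoundedContinuousFunction

/-- Fed with the noise of `M`, the empty system almost surely coincides with `M` from some random
time on; dominated convergence concludes. -/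
theorem tendsto_integral_X_sub [Fact (0 < lam)] [hμ : Fact (0 < μ)] (hn : 1 ≤ n) (hθ : 0 < θ)
    {Ω : Type*} [MeasurableSpace Ω] {P : Measure Ω} [IsProbabilityMeasure P]
    (M : System P n lam μ θ) (f : ℕ →ᵇ ℝ) :
    Tendsto (fun t : ℝ≥0 => ∫ ω, f (M.X t ω) ∂P - ∫ d, f (emptyPath n μ θ d t) ∂(noiseLaw lam μ))
      atTop (nhds 0) := by
  have hc : 0 < 1 + μ / θ := by have := hμ.out; positivity
  have hfm : Measurable f := measurable_from_nat
  have hEt : ∀ t, Measurable fun d => emptyPath n μ θ d t :=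
    measurable_pi_iff.1 (measurable_emptyPath hn)
  have hint : ∀ g : Ω → ℕ, Measurable g → Integrable (fun ω => f (g ω)) P := fun g hg =>
    Integrable.of_bound (hfm.comp hg).aestronglyMeasurable ‖f‖
      (ae_of_all _ fun ω => f.norm_coe_le_norm _)
  have e : ∀ t : ℝ≥0, ∫ ω, f (M.X t ω) ∂P - ∫ d, f (emptyPath n μ θ d t) ∂(noiseLaw lam μ) =
      ∫ ω, (f (M.X t ω) - f (emptyPath n μ θ (M.noise ω) t)) ∂P := by
    intro t
    have h1 := hint _ (M.measurable_X hn t)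
    have h2 : Integrable (fun ω => f (emptyPath n μ θ (M.noise ω) t)) P :=
      hint _ ((hEt t).comp M.measurable_noise)
    have h3 : AEStronglyMeasurable (fun d => f (emptyPath n μ θ d t)) (P.map M.noise) :=
      (hfm.comp (hEt t)).aestronglyMeasurable
    rw [integral_sub h1 h2, ← M.map_noise, integral_map M.measurable_noise.aemeasurable h3]
  simp only [e]
  rw [← integral_zero Ω ℝ (μ := P)]
  refine tendsto_integral_filter_of_dominated_convergence (fun _ => 2 * ‖f‖)
    (Eventually.of_forall fun t => ?_) (Eventually.of_forall fun t => ae_of_all _ fun ω => ?_)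
    (integrable_const _) ?_
  · exact ((hfm.comp (M.measurable_X hn t)).sub
      (hfm.comp ((hEt t).comp M.measurable_noise))).aestronglyMeasurable
  · refine (norm_sub_le _ _).trans ?_
    linarith [f.norm_coe_le_norm (M.X t ω), f.norm_coe_le_norm (emptyPath n μ θ (M.noise ω) t)]
  · have hae : ∀ᵐ ω ∂P, Good (M.noise ω) ∧ M.noise ω ∈ recurrentSet (1 + μ / θ) := by
      have h : ∀ᵐ d ∂(P.map M.noise), Good d ∧ d ∈ recurrentSet (1 + μ / θ) := by
        rw [M.map_noise]
        exact ae_good_noiseLaw.and (ae_mem_recurrentSet hc)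
      exact ae_of_ae_map M.measurable_noise.aemeasurable h
    filter_upwards [hae] with ω hω
    refine tendsto_const_nhds.congr' ?_
    filter_upwards [hω.1.eventually_pathFrom_eq (n := n) hω.2 (M.initState ω)] with t ht
    rw [M.X_eq_pathFrom, ht, sub_self]

/-- For the stationary system the integral is constant in time, so the empty system must converge to
that constant. As the left side does not involve `π`, uniqueness follows. -/
theorem tendsto_integral_emptyPath [Fact (0 < lam)] [Fact (0 < μ)] (hn : 1 ≤ n) (hθ : 0 < θ)
    {π : Measure ℕ} (hπ : IsSteadyState n lam μ θ π) (f : ℕ →ᵇ ℝ) :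
    Tendsto (fun t : ℝ≥0 => ∫ d, f (emptyPath n μ θ d t) ∂(noiseLaw lam μ)) atTop
      (nhds (∫ k, f k ∂π)) := by
  obtain ⟨Ω, _, P, _, M, -, hlaw⟩ := hπ
  have h := (tendsto_integral_X_sub hn hθ M f).const_sub (∫ k, f k ∂π)
  rw [sub_zero] at h
  refine h.congr fun t => ?_
  have e : ∫ ω, f (M.X t ω) ∂P = ∫ k, f k ∂π := by
    rw [← (hlaw t).map_eq, integral_map (hlaw t).aemeasurable
      (measurable_from_nat (f := f)).aestronglyMeasurable]
  rw [e]
  ring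

theorem IsSteadyState.isProbabilityMeasure {π : Measure ℕ} (hπ : IsSteadyState n lam μ θ π) :
    IsProbabilityMeasure π := by
  obtain ⟨Ω, _, P, _, M, -, hlaw⟩ := hπ
  rw [← (hlaw 0).map_eq]
  exact Measure.isProbabilityMeasure_map (hlaw 0).aemeasurable

end Convergence

end MpcQueue

theorem mainTheorem6 (n : ℕ) (hn : 1 ≤ n) (lam μ θ : ℝ) (hlam : 0 < lam) (hμ : 0 < μ)
    (hθ : 0 < θ) :
    ∃ π : ProbabilityMeasure ℕ,
      MpcQueue.IsSteadyState n lam μ θ π ∧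
      (∀ π' : Measure ℕ, MpcQueue.IsSteadyState n lam μ θ π' → π' = π) ∧
      ∀ (Ω : Type*) [MeasurableSpace Ω] (P : Measure Ω) [IsProbabilityMeasure P]
        (M : MpcQueue.System P n lam μ θ),
        TendstoInDistribution M.X atTop (id : ℕ → ℕ) (fun _ => P) (π : Measure ℕ) := by
  have : Fact (0 < lam) := ⟨hlam⟩
  have : Fact (0 < μ) := ⟨hμ⟩
  obtain ⟨π, hπ⟩ := MpcQueue.exists_isSteadyState (lam := lam) (μ := μ) hn hθ
  refine ⟨π, hπ, fun π' hπ' => ?_, fun Ω _ P _ M => ?_⟩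
  · have := hπ'.isProbabilityMeasure
    exact ext_of_forall_integral_eq_of_IsFiniteMeasure fun f => tendsto_nhds_unique
      (MpcQueue.tendsto_integral_emptyPath hn hθ hπ' f)
      (MpcQueue.tendsto_integral_emptyPath hn hθ hπ f)
  · have hX := M.measurable_X hn
    refine ⟨fun t => (hX t).aemeasurable, aemeasurable_id,
      ProbabilityMeasure.tendsto_iff_forall_integral_tendsto.2 fun f => ?_⟩
    have h := (MpcQueue.tendsto_integral_X_sub hn hθ M f).add
      (MpcQueue.tendsto_integral_emptyPath hn hθ hπ f)
    rw [zero_add] at h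
    simp only [ProbabilityMeasure.coe_mk, Measure.map_id]
    refine h.congr fun t => ?_
    rw [sub_add_cancel, integral_map (hX t).aemeasurable
      (measurable_from_nat (f := f)).aestronglyMeasurable]
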